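/- Let $(W,S)$ be a Coxeter system, with $m_{st}$ the order of $st$, and let $\mathcal R$ be its set of reflections, i.e. of conjugates of elements of $S$. Let $\mathbf k$ be a commutative ring with $1$ and let $\underline u=(u_s)_{s\in S}$ be a family of elements of $\mathbf k$ with $u_s=u_t$ whenever $s,t\in S$ are conjugate in $W$. Let $\mathcal C_W(\underline u)$ be the associative unital $\mathbf k$-algebra with generators $g_s$ ($s\in S$), $e_t$ ($t\in\mathcal R$) and relations 1. $\underbrace{g_sg_tg_s\cdots}_{m_{st}}=\underbrace{g_tg_sg_t\cdots}_{m_{st}}$ for $s,t\in S$ with $m_{st}<\infty$; 2. $e_t^2=e_t$ for $t\in\mathcal R$; 3. $e_{t}e_{t'}=e_{t'}e_{t}$ for $t,t'\in\mathcal R$; 4. $e_te_{t'}=e_te_{tt't^{-1}}$ for $t,t'\in\mathcal R$; 5. $g_se_t=e_{sts}g_s$ for $s\in S$, $t\in\mathcal R$; 6. $g_s^2=1+(u_s-1)e_s(1+g_s)$ for $s\in S$. For a finite subset $J\subset\mathcal R$ let $\langle J\rangle$ be the subgroup of $W$ generated by $J$ and put $e_J=\prod_{t\in J}e_t$. Let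 $\mathcal W$ be the set of finitely generated reflection subgroups of $W$, i.e. of the subgroups $\langle J\rangle$ with $J\subset\mathcal R$ finite, on which $W$ acts by conjugation. Let $H_W(\underline u)$ be the Iwahori–Hecke algebra, i.e. the unital $\mathbf k$-algebra with generators $T_s$ ($s\in S$), subject to the braid relations as in (1) and to $T_s^2=u_s+(u_s-1)T_s$ for $s\in S$, and let $\mathfrak p:\mathcal C_W(\underline u)\twoheadrightarrow H_W(\underline u)$ be the surjective morphism of $\mathbf k$-algebras with $g_s\mapsto T_s$ for $s\in S$ and $e_t\mapsto 1$ for $t\in\mathcal R$. Proposition. Let $\mathcal F$ be a $W$-set and let $p:\mathcal W\to\mathcal F$ be a surjective $W$-equivariant map such that, for all $H,K\in\mathcal W$, $p(H)=p(K)$ implies $p(\langle H,s\rangle)=p(\langle K,s\rangle)$ for all $s\in S$. Let $I_p$ be the two-sided ideal of $\mathcal C_W(\underline u)$ generated by the elements $e_J-e_K$, for $J,K\subset\mathcal R$ finite with $p(\langle J\rangle)=p(\langle K\rangle)$. Then the quotient algebra $\mathcal C_W^{\mathcal F}(\underline u)=\mathcal C_W(\underline u)/I_p$ is a free $\mathbf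 k$-module and, if $W$ is finite, it has a basis with $|W|\cdot|\mathcal F|$ elements. Moreover $\mathfrak p$ factors through the natural projection $\mathcal C_W(\underline u)\twoheadrightarrow\mathcal C_W^{\mathcal F}(\underline u)$: there is a (surjective) morphism of $\mathbf k$-algebras $\mathcal C_W^{\mathcal F}(\underline u)\to H_W(\underline u)$ whose composite with this projection is $\mathfrak p$. -/

import Mathlib

noncomputable section

namespace CoxeterSystem

variable {B W : Type*} [Group W] {M : CoxeterMatrix B} (cs : CoxeterSystem M W)

/-- The type of reflections of a Coxeter system: the conjugates of the simple reflections. -/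
abbrev Refl : Type _ := {t : W // cs.IsReflection t}

/-- A simple reflection, as a reflection. -/
def reflSimple (i : B) : cs.Refl := ⟨cs.simple i, cs.isReflection_simple i⟩

/-- The conjugate `w t w⁻¹` of a reflection `t`. -/
def reflConj (w : W) (t : cs.Refl) : cs.Refl := ⟨w * t.1 * w⁻¹, t.2.conj w⟩

/-- The set of finitely generated reflection subgroups: the subgroups of `W` that are generated
by a finite set of reflections. -/
def FGReflSubgroup : Type _ :=
  {H : Subgroup W // ∃ J : Finset cs.Refl, Subgroup.closure (Subtype.val '' (J : Set cs.Refl)) = H}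

/-- The subgroup `⟨J⟩` generated by a finite set `J` of reflections. -/
def reflSpan (J : Finset cs.Refl) : cs.FGReflSubgroup :=
  ⟨Subgroup.closure (Subtype.val '' (J : Set cs.Refl)), J, rfl⟩

/-- The subgroup `⟨H, s⟩` generated by a finitely generated reflection subgroup `H` and
the simple reflection `s = cs.simple i`. -/
def adjoinSimple (H : cs.FGReflSubgroup) (i : B) : cs.FGReflSubgroup :=
  ⟨H.1 ⊔ Subgroup.closure {cs.simple i}, by
    classical
    obtain ⟨J, hJ⟩ := H.2
    refine ⟨J ∪ {cs.reflSimple i}, ?_⟩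
    rw [← hJ, ← Subgroup.closure_union, Finset.coe_union, Set.image_union, Finset.coe_singleton,
      Set.image_singleton, reflSimple]⟩

/-- `W` acts on its finitely generated reflection subgroups by conjugation,
`w • H = w H w⁻¹`. -/
instance : MulAction W cs.FGReflSubgroup where
  smul w H := ⟨H.1.map (MulAut.conj w).toMonoidHom, by
    classical
    obtain ⟨J, hJ⟩ := H.2
    refine ⟨J.image (cs.reflConj w), ?_⟩
    rw [← hJ, MonoidHom.map_closure, Finset.coe_image, Set.image_image, Set.image_image]
    rfl⟩
  one_smul H := by
    apply Subtype.ext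
    change H.1.map (MulAut.conj (1 : W)).toMonoidHom = H.1
    ext x
    simp [Subgroup.mem_map]
  mul_smul v w H := by
    apply Subtype.ext
    change H.1.map (MulAut.conj (v * w)).toMonoidHom =
      (H.1.map (MulAut.conj w).toMonoidHom).map (MulAut.conj v).toMonoidHom
    rw [Subgroup.map_map]
    congr 1
    ext x
    simp

section Algebras

variable {k : Type*} [CommRing k] (u : B → k)

/-- Generators of the algebra `C_W(u)`. -/
inductive ExtHeckeGen : Type _
  | g (i : B) : ExtHeckeGen
  | e (t : cs.Refl) : ExtHeckeGen

/-- Product of the free generators `g` along a word in the simple reflections. -/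
def gWordFree (k : Type*) [CommRing k] (ω : List B) : FreeAlgebra k cs.ExtHeckeGen :=
  (ω.map fun i => FreeAlgebra.ι k (ExtHeckeGen.g i)).prod

/-- Defining relations of `C_W(u)`. If `M i j = 0`, i.e. `m_{ij} = ∞`, both braid words are
empty, so that there is no braid relation. -/
inductive ExtHeckeRel :
    FreeAlgebra k cs.ExtHeckeGen → FreeAlgebra k cs.ExtHeckeGen → Prop
  | braid (i j : B) : ExtHeckeRel
      (cs.gWordFree k (braidWord M i j)) (cs.gWordFree k (braidWord M j i))
  | idem (t : cs.Refl) : ExtHeckeRel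
      (FreeAlgebra.ι k (ExtHeckeGen.e t) * FreeAlgebra.ι k (ExtHeckeGen.e t))
      (FreeAlgebra.ι k (ExtHeckeGen.e t))
  | comm (t t' : cs.Refl) : ExtHeckeRel
      (FreeAlgebra.ι k (ExtHeckeGen.e t) * FreeAlgebra.ι k (ExtHeckeGen.e t'))
      (FreeAlgebra.ι k (ExtHeckeGen.e t') * FreeAlgebra.ι k (ExtHeckeGen.e t))
  | conj (t t' : cs.Refl) : ExtHeckeRel
      (FreeAlgebra.ι k (ExtHeckeGen.e t) * FreeAlgebra.ι k (ExtHeckeGen.e t'))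
      (FreeAlgebra.ι k (ExtHeckeGen.e t) *
        FreeAlgebra.ι k (ExtHeckeGen.e (cs.reflConj t.1 t')))
  | ge (i : B) (t : cs.Refl) : ExtHeckeRel
      (FreeAlgebra.ι k (ExtHeckeGen.g i) * FreeAlgebra.ι k (ExtHeckeGen.e t))
      (FreeAlgebra.ι k (ExtHeckeGen.e (cs.reflConj (cs.simple i) t)) *
        FreeAlgebra.ι k (ExtHeckeGen.g i))
  | quad (i : B) : ExtHeckeRel
      (FreeAlgebra.ι k (ExtHeckeGen.g i) * FreeAlgebra.ι k (ExtHeckeGen.g i))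
      (1 + (u i - 1) • (FreeAlgebra.ι k (ExtHeckeGen.e (cs.reflSimple i)) *
        (1 + FreeAlgebra.ι k (ExtHeckeGen.g i))))

/-- The algebra `C_W(u)`, by generators and relations. -/
abbrev ExtHecke : Type _ := RingQuot (cs.ExtHeckeRel u)

namespace ExtHecke

/-- The generator `g_s` of `C_W(u)`, for `s = cs.simple i`. -/
def g (i : B) : cs.ExtHecke u :=
  RingQuot.mkAlgHom k (cs.ExtHeckeRel u) (FreeAlgebra.ι k (ExtHeckeGen.g i))

/-- The generator `e_t` of `C_W(u)`, for a reflection `t`. -/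
def e (t : cs.Refl) : cs.ExtHecke u :=
  RingQuot.mkAlgHom k (cs.ExtHeckeRel u) (FreeAlgebra.ι k (ExtHeckeGen.e t))

theorem e_commute (t t' : cs.Refl) : Commute (e cs u t) (e cs u t') := by
  have h := RingQuot.mkAlgHom_rel k (ExtHeckeRel.comm (cs := cs) (u := u) t t')
  rw [map_mul, map_mul] at h
  exact h

/-- The element `e_J`, the product of the commuting elements `e_t` for `t ∈ J`. -/
def eProd (J : Finset cs.Refl) : cs.ExtHecke u :=
  J.noncommProd (e cs u) fun t _ t' _ _ => e_commute cs u t t'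

/-- For `p : 𝒲 → F`, the two-sided ideal `I_p` generated by the differences `e_J - e_K`
with `p ⟨J⟩ = p ⟨K⟩`. -/
def idealOf {F : Type*} (p : cs.FGReflSubgroup → F) : TwoSidedIdeal (cs.ExtHecke u) :=
  TwoSidedIdeal.span {x | ∃ J K : Finset cs.Refl,
    p (cs.reflSpan J) = p (cs.reflSpan K) ∧ x = eProd cs u J - eProd cs u K}

/-- The quotient algebra `C_W(u) / I_p`. -/
abbrev QuotBy {F : Type*} (p : cs.FGReflSubgroup → F) : Type _ :=
  (idealOf cs u p).ringCon.Quotient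

/-- The natural projection `C_W(u) → C_W(u) / I_p`. -/
abbrev quotByMk {F : Type*} (p : cs.FGReflSubgroup → F) : cs.ExtHecke u →ₐ[k] QuotBy cs u p :=
  RingCon.mkₐ k (idealOf cs u p).ringCon

end ExtHecke

/-- Product of the free generators `T` along a word in the simple reflections. -/
def tWordFree (k : Type*) [CommRing k] (ω : List B) : FreeAlgebra k B :=
  (ω.map (FreeAlgebra.ι k)).prod

/-- Defining relations of the Iwahori-Hecke algebra: the braid relations and
`T_s ^ 2 = u_s + (u_s - 1) T_s`. -/
inductive IwahoriHeckeRel (M : CoxeterMatrix B) (u : B → k) :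
    FreeAlgebra k B → FreeAlgebra k B → Prop
  | braid (i j : B) : IwahoriHeckeRel M u
      (tWordFree k (braidWord M i j)) (tWordFree k (braidWord M j i))
  | quad (i : B) : IwahoriHeckeRel M u
      (FreeAlgebra.ι k i * FreeAlgebra.ι k i)
      (u i • 1 + (u i - 1) • FreeAlgebra.ι k i)

/-- The Iwahori-Hecke algebra `H_W(u)`, by generators and relations. -/
abbrev IwahoriHecke (M : CoxeterMatrix B) (u : B → k) : Type _ :=
  RingQuot (IwahoriHeckeRel M u)

/-- The generator `T_s` of `H_W(u)`, for `s = cs.simple i`. -/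
def IwahoriHecke.T (M : CoxeterMatrix B) (u : B → k) (i : B) : IwahoriHecke M u :=
  RingQuot.mkAlgHom k (IwahoriHeckeRel M u) (FreeAlgebra.ι k i)

namespace ExtHecke

/-- The assignment `g_s ↦ T_s`, `e_t ↦ 1` on the free algebra. -/
def toIwahoriHeckeFree : FreeAlgebra k cs.ExtHeckeGen →ₐ[k] IwahoriHecke M u :=
  FreeAlgebra.lift k fun
    | ExtHeckeGen.g i => IwahoriHecke.T M u i
    | ExtHeckeGen.e _ => 1

theorem toIwahoriHeckeFree_g (i : B) :
    toIwahoriHeckeFree cs u (FreeAlgebra.ι k (ExtHeckeGen.g i)) = IwahoriHecke.T M u i := by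
  simp [toIwahoriHeckeFree]

theorem toIwahoriHeckeFree_e (t : cs.Refl) :
    toIwahoriHeckeFree cs u (FreeAlgebra.ι k (ExtHeckeGen.e t)) = 1 := by
  simp [toIwahoriHeckeFree]

theorem toIwahoriHeckeFree_word (ω : List B) :
    toIwahoriHeckeFree cs u (cs.gWordFree k ω) =
      RingQuot.mkAlgHom k (IwahoriHeckeRel M u) (tWordFree k ω) := by
  induction ω with
  | nil => simp [gWordFree, tWordFree]
  | cons i ω ih =>
    simp only [gWordFree, tWordFree, List.map_cons, List.prod_cons, map_mul] at ih ⊢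
    rw [ih, toIwahoriHeckeFree_g, IwahoriHecke.T]

theorem toIwahoriHeckeFree_rel ⦃x y : FreeAlgebra k cs.ExtHeckeGen⦄
    (h : cs.ExtHeckeRel u x y) :
    toIwahoriHeckeFree cs u x = toIwahoriHeckeFree cs u y := by
  cases h with
  | braid i j =>
    rw [toIwahoriHeckeFree_word, toIwahoriHeckeFree_word]
    exact RingQuot.mkAlgHom_rel k (IwahoriHeckeRel.braid i j)
  | idem t => simp [toIwahoriHeckeFree_e]
  | comm t t' => simp [toIwahoriHeckeFree_e]
  | conj t t' => simp [toIwahoriHeckeFree_e]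
  | ge i t => simp [toIwahoriHeckeFree_e]
  | quad i =>
    have h := RingQuot.mkAlgHom_rel k (IwahoriHeckeRel.quad (M := M) (u := u) i)
    simp only [map_mul, map_add, map_smul, map_one] at h
    simp only [map_mul, map_add, map_smul, map_one, toIwahoriHeckeFree_e, toIwahoriHeckeFree_g,
      one_mul, IwahoriHecke.T, h]
    rw [smul_add, sub_smul, one_smul]
    abel

/-- The algebra morphism `C_W(u) → H_W(u)` with `g_s ↦ T_s` and `e_t ↦ 1`. -/
def toIwahoriHecke : cs.ExtHecke u →ₐ[k] IwahoriHecke M u :=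
  RingQuot.liftAlgHom k ⟨toIwahoriHeckeFree cs u, toIwahoriHeckeFree_rel cs u⟩

end ExtHecke

end Algebras

end CoxeterSystem

end

namespace CoxeterSystem

variable {B W : Type*} [Group W] {M : CoxeterMatrix B} (cs : CoxeterSystem M W)

/-! The quotient has the basis `e_f g_w`, for `(f, w)` in `F × W`, where `e_f` is the class of `e_J`
for any `J` with `p ⟨J⟩ = f`. The argument is the one that gives the standard basis of a Hecke
algebra.

On the free module on `F × W`, let `e_t` act by joining `t` to `f`, and let `g_s` act by the formula
that the relations force on `e_f g_w`, with a correction term when `s` is a left descent of `w`.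
Every relation except the braid relations is a direct check. For the braid relations one introduces
operators of right multiplication. They commute with the left ones (`ReflJoin.opL_comm_opR`) and
carry the vectors `(f, 1)` to all basis vectors, so an identity between left operators can be tested
on the `(f, 1)` (`ReflJoin.eq_of_comm_opR`). There both braid words, being reduced, give the same
vector.

In the other direction, Matsumoto's theorem makes `g_w` well defined, and the linear map `(f, w) ↦
e_f g_w` intertwines this action with left multiplication on the quotient (`ExtHecke.ofMod_rep`).
Its inverse is the action on the basis vector given by the trivial subgroup and `1`. The morphism to
the Hecke algebra descends because it sends every `e_J` to `1`.

Two facts on Coxeter groups carry this: the behaviour of descents, with the exchange condition,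
comes from the parity of inversions; the order of `s_i s_j` is exactly `M i j`, by the geometric
representation, so braid words are reduced and Matsumoto's theorem can be proved. -/

/-! ### Alternating words -/

theorem alternatingWord_add_two (i j : B) (m : ℕ) :
    alternatingWord i j (2 * (m + 1)) = i :: j :: alternatingWord i j (2 * m) := by
  rw [mul_add, mul_one, alternatingWord_succ', alternatingWord_succ']
  simp

theorem prod_map_alternatingWord_two_mul {G : Type*} [Monoid G] (f : B → G) (i j : B) (m : ℕ) :
    ((alternatingWord i j (2 * m)).map f).prod = (f i * f j) ^ m := by
  induction m with
  | zero => simp [alternatingWord]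
  | succ m ih => rw [alternatingWord_add_two]; simp [ih, pow_succ', mul_assoc]

theorem reverse_alternatingWord_two_mul (i j : B) (m : ℕ) :
    (alternatingWord i j (2 * m)).reverse = alternatingWord j i (2 * m) := by
  induction m with
  | zero => simp [alternatingWord]
  | succ m ih =>
    rw [alternatingWord_add_two, List.reverse_cons, List.reverse_cons, ih, mul_add, mul_one,
      alternatingWord_succ, alternatingWord_succ]
    simp

/-! ### Parity of inversions, descents and the exchange condition -/

theorem end_mul_apply {X : Type*} (f g : Function.End X) (x : X) : (f * g) x = f (g x) := rfl

open Classical in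
/-- The permutation `(t, ε) ↦ (s t s, ε + [t = s])` attached to a simple reflection `s`. -/
noncomputable def signedConj (i : B) : Function.End (W × ZMod 2) := fun x =>
  (cs.simple i * x.1 * cs.simple i, x.2 + if x.1 = cs.simple i then 1 else 0)

-- A letter `i` put in front of `ω` adds `ω⁻¹ s_i ω` to the right inversion sequence, and this
-- equals `t` exactly when `t`, conjugated by `ω`, arrives at `s_i`, which is when the sign flips.
open Classical in
theorem prod_signedConj (ω : List B) (t : W) (ε : ZMod 2) :
    (ω.map cs.signedConj).prod (t, ε) =
      (cs.wordProd ω * t * (cs.wordProd ω)⁻¹, ε + ((cs.rightInvSeq ω).count t : ℕ)) := by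
  induction ω with
  | nil => simp; rfl
  | cons i ω ih =>
    rw [List.map_cons, List.prod_cons, end_mul_apply, ih]
    have : cs.wordProd ω * t * (cs.wordProd ω)⁻¹ = cs.simple i ↔
        (cs.wordProd ω)⁻¹ * cs.simple i * cs.wordProd ω = t := by
      constructor <;> rintro h
      · rw [← h]; group
      · rw [← h]; group
    simp only [signedConj, rightInvSeq, List.count_cons, this, wordProd_cons, mul_inv_rev,
      inv_simple, beq_iff_eq, Prod.mk.injEq]
    refine ⟨by group, ?_⟩
    split_ifs <;> push_cast <;> ring

theorem wordProd_alternatingWord_odd (i j : B) (k : ℕ) :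
    cs.wordProd (alternatingWord j i (2 * k + 1)) = cs.simple i * (cs.simple j * cs.simple i) ^ k := by
  rw [prod_alternatingWord_eq_mul_pow]
  have h : (2 * k + 1) / 2 = k := by lia
  rw [h, if_neg (by simp)]

theorem leftInvSeq_alternatingWord_two_mul (i j : B) (m : ℕ) :
    cs.leftInvSeq (alternatingWord i j (2 * m)) =
      (List.range (2 * m)).map fun k => cs.simple i * (cs.simple j * cs.simple i) ^ k := by
  apply List.ext_getElem
  · simp
  · intro k h₁ h₂
    simp only [List.getElem_map, List.getElem_range]
    rw [getElem_leftInvSeq_alternatingWord cs i j m k (by simpa using h₁),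
      wordProd_alternatingWord_odd]

/-- The `2m` inversions of the word `(s_i s_j)^m`, with `m = M i j`, are periodic of period `m`,
because `(s_i s_j)^m = 1`. Each reflection is therefore counted an even number of times. -/
theorem isLiftable_signedConj : M.IsLiftable cs.signedConj := by
  classical
  intro i j
  rw [← prod_map_alternatingWord_two_mul]
  funext ⟨t, ε⟩
  rw [prod_signedConj, ← reverse_alternatingWord_two_mul, rightInvSeq_reverse,
    leftInvSeq_alternatingWord_two_mul, reverse_alternatingWord_two_mul, wordProd,
    prod_map_alternatingWord_two_mul, simple_mul_simple_pow, List.count_reverse, two_mul,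
    List.range_add, List.map_append, List.map_map, List.count_append]
  have : ((fun k => cs.simple j * (cs.simple i * cs.simple j) ^ k) ∘ fun x => M i j + x) =
      fun k => cs.simple j * (cs.simple i * cs.simple j) ^ k := by
    funext k
    simp [pow_add]
  rw [this]
  have h2 (n : ZMod 2) : n + n = 0 := CharTwo.add_self_eq_zero n
  simp [h2]
  rfl

/-- The action of `W` on `W × ℤ/2` whose second component records right inversions. -/
noncomputable def signedConjHom : W →* Function.End (W × ZMod 2) := cs.lift ⟨cs.signedConj, cs.isLiftable_signedConj⟩

open Classical in
theorem signedConjHom_wordProd (ω : List B) (t : W) (ε : ZMod 2) :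
    cs.signedConjHom (cs.wordProd ω) (t, ε) =
      (cs.wordProd ω * t * (cs.wordProd ω)⁻¹, ε + ((cs.rightInvSeq ω).count t : ℕ)) := by
  rw [← prod_signedConj, wordProd, map_list_prod, List.map_map]
  have : cs.signedConjHom ∘ cs.simple = cs.signedConj :=
    funext fun i => cs.lift_apply_simple cs.isLiftable_signedConj i
  rw [this]

/-- The parity of the number of occurrences of `t` in the right inversion sequence of a word
for `w`. -/
noncomputable def inversionParity (w t : W) : ZMod 2 := (cs.signedConjHom w (t, 0)).2

open Classical in
theorem inversionParity_wordProd (ω : List B) (t : W) :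
    cs.inversionParity (cs.wordProd ω) t = ((cs.rightInvSeq ω).count t : ℕ) := by
  rw [inversionParity, signedConjHom_wordProd, zero_add]

theorem signedConjHom_apply (w t : W) (ε : ZMod 2) :
    cs.signedConjHom w (t, ε) = (w * t * w⁻¹, ε + cs.inversionParity w t) := by
  obtain ⟨ω, rfl⟩ := cs.wordProd_surjective w
  rw [inversionParity_wordProd, signedConjHom_wordProd]

theorem inversionParity_mul (v w t : W) :
    cs.inversionParity (v * w) t = cs.inversionParity w t + cs.inversionParity v (w * t * w⁻¹) := by
  rw [inversionParity, map_mul, end_mul_apply, signedConjHom_apply,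
    signedConjHom_apply, zero_add]

open Classical in
theorem inversionParity_simple (i : B) (t : W) :
    cs.inversionParity (cs.simple i) t = if t = cs.simple i then 1 else 0 := by
  have := cs.inversionParity_wordProd [i] t
  rw [wordProd_singleton] at this
  rw [this, rightInvSeq_singleton]
  rw [List.count_singleton]
  simp only [beq_iff_eq, eq_comm (a := cs.simple i)]
  split_ifs <;> simp

open Classical in
theorem mem_rightInvSeq_of_inversionParity_ne_zero {ω : List B} {t : W}
    (h : cs.inversionParity (cs.wordProd ω) t ≠ 0) : t ∈ cs.rightInvSeq ω := by
  rw [inversionParity_wordProd] at h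
  by_contra h'
  rw [List.count_eq_zero_of_not_mem h'] at h
  simp at h

theorem isRightDescent_iff_inversionParity (w : W) (i : B) :
    cs.IsRightDescent w i ↔ cs.inversionParity w (cs.simple i) = 1 := by
  have key (w : W) (h : cs.inversionParity w (cs.simple i) = 1) : cs.IsRightDescent w i := by
    obtain ⟨ω, hω, rfl⟩ := cs.exists_isReduced w
    rw [← isRightInversion_simple_iff_isRightDescent]
    exact cs.isRightInversion_of_mem_rightInvSeq hω
      (cs.mem_rightInvSeq_of_inversionParity_ne_zero (by rw [h]; decide))
  -- Right multiplication by `s_i` flips both the parity at `s_i` and the descent, so the converse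
  -- is the first implication applied to `w s_i`.
  refine ⟨fun h => ?_, key w⟩
  by_contra h'
  rw [isRightDescent_iff_not_isRightDescent_mul] at h
  apply h
  apply key
  rw [inversionParity_mul, inversionParity_simple, if_pos rfl]
  have key2 : ∀ x : ZMod 2, x ≠ 1 → 1 + x = 1 := by decide
  simpa using key2 _ h'

/-- By the cocycle rule, the parities of `w⁻¹` and `s_j w⁻¹` at `s_i` differ only if `w⁻¹ s_i w =
s_j`, which `h` excludes. -/
theorem isLeftDescent_mul_simple_iff {w : W} {i j : B}
    (h : cs.simple i * w ≠ w * cs.simple j) :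
    cs.IsLeftDescent (w * cs.simple j) i ↔ cs.IsLeftDescent w i := by
  rw [← isRightDescent_inv_iff, ← isRightDescent_inv_iff, isRightDescent_iff_inversionParity,
    isRightDescent_iff_inversionParity, mul_inv_rev, inversionParity_mul, inv_simple,
    inversionParity_simple, if_neg, add_zero]
  intro h'
  apply h
  rw [← h']
  group

/-- Exchange condition: odd parity puts `s_i` into the inversion sequence, and multiplying by the
entry at position `r` deletes the letter there. -/
theorem exists_mul_simple_eq_eraseIdx {ω : List B} {i : B}
    (h : cs.IsRightDescent (cs.wordProd ω) i) :
    ∃ r < ω.length, cs.wordProd ω * cs.simple i = cs.wordProd (ω.eraseIdx r) := by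
  rw [isRightDescent_iff_inversionParity] at h
  have := cs.mem_rightInvSeq_of_inversionParity_ne_zero (ω := ω) (by rw [h]; decide)
  obtain ⟨r, hr, hr'⟩ := List.mem_iff_getElem.mp this
  refine ⟨r, by simpa using hr, ?_⟩
  rw [← wordProd_mul_getD_rightInvSeq, List.getD_eq_getElem _ _ hr, hr']

/-- Without repetitions every inversion has odd parity. Parity depends only on the group element, so
these inversions all occur for a reduced word too, which is then at least as long. -/
theorem isReduced_of_nodup_rightInvSeq {ω : List B} (h : (cs.rightInvSeq ω).Nodup) :
    cs.IsReduced ω := by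
  classical
  obtain ⟨ω', hω', he⟩ := cs.exists_isReduced (cs.wordProd ω)
  have hsub : cs.rightInvSeq ω ⊆ cs.rightInvSeq ω' := fun t ht => by
    apply cs.mem_rightInvSeq_of_inversionParity_ne_zero
    rw [← he, inversionParity_wordProd, List.count_eq_one_of_mem h ht]
    decide
  have := (h.subperm hsub).length_le
  rw [length_rightInvSeq, length_rightInvSeq] at this
  apply le_antisymm (cs.length_wordProd_le ω)
  rw [he, hω'.eq]
  exact this

/-! ### The geometric representation and the order of a product of two simple reflections -/

section Geometric

variable (M)

/-- The bilinear form of the geometric representation, paired with a basis vector. -/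
noncomputable def geomForm (i : B) : (B →₀ ℝ) →ₗ[ℝ] ℝ :=
  Finsupp.linearCombination ℝ fun j => -Real.cos (Real.pi / M i j)

/-- The simple reflections of the geometric representation. -/
noncomputable def geomRefl (i : B) : Module.End ℝ (B →₀ ℝ) :=
  1 - (2 : ℝ) • (geomForm M i).smulRight (Finsupp.single i 1)

theorem geomForm_single (i j : B) :
    geomForm M i (Finsupp.single j 1) = -Real.cos (Real.pi / M i j) := by
  simp [geomForm]

theorem geomForm_self (i : B) : geomForm M i (Finsupp.single i 1) = 1 := by
  simp [geomForm_single]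

theorem geomRefl_apply (i : B) (v : B →₀ ℝ) :
    geomRefl M i v = v - (2 * geomForm M i v) • Finsupp.single i 1 := by
  simp [geomRefl]

theorem geomRefl_mul_self (i : B) : geomRefl M i * geomRefl M i = 1 := by
  ext1 j
  ext1
  simp only [Module.End.mul_apply, geomRefl_apply, map_sub, map_smul, geomForm_self,
    LinearMap.comp_apply, Module.End.one_apply]
  module

theorem geomRefl_mul_apply {i j : B} (v : B →₀ ℝ) :
    (geomRefl M j * geomRefl M i) v = v - (2 * geomForm M i v) • Finsupp.single i 1 -
      (2 * geomForm M j v + 4 * Real.cos (Real.pi / M i j) * geomForm M i v) •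
        Finsupp.single j 1 := by
  simp only [Module.End.mul_apply, geomRefl_apply, map_sub, map_smul, geomForm_single,
    M.symmetric j i]
  module

/-- The product rotates the plane of the two roots by twice the angle `π / m`; the coefficients obey
the recurrence `sin (x + θ) = 2 cos θ sin x - sin (x - θ)`. The factor `sin θ` on the left avoids a
division. -/
theorem geomRefl_mul_pow_single_right (i j : B) (n : ℕ) :
    Real.sin (Real.pi / M i j) • ((geomRefl M j * geomRefl M i) ^ n) (Finsupp.single j 1) =
      Real.sin ((2 * n + 1) * (Real.pi / M i j)) • Finsupp.single j 1 +
        Real.sin (2 * n * (Real.pi / M i j)) • Finsupp.single i 1 := by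
  induction n with
  | zero => simp
  | succ n ih =>
    set θ := Real.pi / M i j with hθ
    rw [pow_succ', Module.End.mul_apply, ← map_smul, ih, map_add, map_smul, map_smul,
      geomRefl_mul_apply, geomRefl_mul_apply]
    simp only [geomForm_self, geomForm_single, M.symmetric j i, ← hθ]
    have h1 : Real.sin (2 * ((n + 1 : ℕ) : ℝ) * θ) =
        2 * Real.cos θ * Real.sin ((2 * n + 1) * θ) - Real.sin (2 * n * θ) := by
      rw [show 2 * ((n + 1 : ℕ) : ℝ) * θ = (2 * n + 1) * θ + θ by push_cast; ring,
        show 2 * (n : ℝ) * θ = (2 * n + 1) * θ - θ by ring, Real.sin_add, Real.sin_sub]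
      ring
    have h2 : Real.sin ((2 * ((n + 1 : ℕ) : ℝ) + 1) * θ) =
        2 * Real.cos θ * Real.sin (2 * ((n + 1 : ℕ) : ℝ) * θ) - Real.sin ((2 * n + 1) * θ) := by
      rw [show (2 * ((n + 1 : ℕ) : ℝ) + 1) * θ = (2 * (n + 1 : ℕ)) * θ + θ by push_cast; ring,
        show (2 * (n : ℝ) + 1) * θ = (2 * (n + 1 : ℕ)) * θ - θ by push_cast; ring,
        Real.sin_add, Real.sin_sub]
      ring
    rw [h2, h1]
    module

theorem geomRefl_mul_pow_single_left (i j : B) (n : ℕ) :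
    Real.sin (Real.pi / M i j) • ((geomRefl M j * geomRefl M i) ^ n) (Finsupp.single i 1) =
      -Real.sin (2 * n * (Real.pi / M i j)) • Finsupp.single j 1 -
        Real.sin ((2 * n - 1) * (Real.pi / M i j)) • Finsupp.single i 1 := by
  induction n with
  | zero => simp
  | succ n ih =>
    set θ := Real.pi / M i j with hθ
    rw [pow_succ', Module.End.mul_apply, ← map_smul, ih, map_sub, map_smul, map_smul,
      geomRefl_mul_apply, geomRefl_mul_apply]
    simp only [geomForm_self, geomForm_single, M.symmetric j i, ← hθ]
    have h1 : Real.sin ((2 * ((n + 1 : ℕ) : ℝ) - 1) * θ) =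
        2 * Real.cos θ * Real.sin (2 * n * θ) - Real.sin ((2 * n - 1) * θ) := by
      rw [show (2 * ((n + 1 : ℕ) : ℝ) - 1) * θ = (2 * n) * θ + θ by push_cast; ring,
        show (2 * (n : ℝ) - 1) * θ = (2 * n) * θ - θ by ring, Real.sin_add, Real.sin_sub]
      ring
    have h2 : Real.sin (2 * ((n + 1 : ℕ) : ℝ) * θ) =
        2 * Real.cos θ * Real.sin ((2 * ((n + 1 : ℕ) : ℝ) - 1) * θ) - Real.sin (2 * n * θ) := by
      rw [show 2 * ((n + 1 : ℕ) : ℝ) * θ = (2 * ((n + 1 : ℕ) : ℝ) - 1) * θ + θ by push_cast; ring,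
        show 2 * (n : ℝ) * θ = (2 * ((n + 1 : ℕ) : ℝ) - 1) * θ - θ by push_cast; ring,
        Real.sin_add, Real.sin_sub]
      ring
    rw [h2, h1]
    module

theorem geomRefl_mul_pow_single_of_eq_zero {i j : B} (h : M i j = 0) (n : ℕ) :
    ((geomRefl M j * geomRefl M i) ^ n) (Finsupp.single j 1) =
      (2 * n + 1 : ℝ) • Finsupp.single j 1 + (2 * n : ℝ) • Finsupp.single i 1 := by
  induction n with
  | zero => simp
  | succ n ih =>
    rw [pow_succ', Module.End.mul_apply, ih, map_add, map_smul, map_smul,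
      geomRefl_mul_apply, geomRefl_mul_apply]
    simp only [geomForm_self, geomForm_single, M.symmetric j i, h]
    -- For `m = ∞`, encoded as `0`, division by zero gives the angle `0` and hence the value `-1` of
    -- the form, as it should be. The powers then grow linearly in `n`.
    simp only [Nat.cast_zero, div_zero, Real.cos_zero]
    push_cast
    module

theorem sin_pi_div_pos {m : ℕ} (h0 : m ≠ 0) (h1 : m ≠ 1) : 0 < Real.sin (Real.pi / m) := by
  have hm : (2 : ℝ) ≤ m := by exact_mod_cast (by lia : 2 ≤ m)
  apply Real.sin_pos_of_pos_of_lt_pi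
  · have := Real.pi_pos
    positivity
  · exact div_lt_self Real.pi_pos (by linarith)

/-- For `m` finite and `i ≠ j`, `sin (π / m)` is nonzero, so the form is nondegenerate on the plane
of the two roots. Every vector is a sum of one in the plane, where the rotation has order dividing
`m`, and one killed by both forms, which is fixed. -/
theorem isLiftable_geomRefl : M.IsLiftable (geomRefl M) := by
  intro j i
  by_cases hij : j = i
  · subst hij
    rw [geomRefl_mul_self, one_pow]
  rw [M.symmetric]
  have h1 := M.off_diagonal i j (Ne.symm hij)
  by_cases h0 : M i j = 0
  · rw [h0, pow_zero]
  have hs := sin_pi_div_pos h0 h1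
  have hm : (M i j : ℝ) * (Real.pi / M i j) = Real.pi := by
    have : (M i j : ℝ) ≠ 0 := by exact_mod_cast h0
    field_simp
  have hj : ((geomRefl M j * geomRefl M i) ^ M i j) (Finsupp.single j 1) = Finsupp.single j 1 := by
    apply smul_right_injective _ hs.ne'
    simp only
    rw [geomRefl_mul_pow_single_right, add_mul, mul_assoc 2, hm, one_mul, add_comm (2 * Real.pi),
      Real.sin_add_two_pi, Real.sin_two_pi]
    simp
  have hi : ((geomRefl M j * geomRefl M i) ^ M i j) (Finsupp.single i 1) = Finsupp.single i 1 := by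
    apply smul_right_injective _ hs.ne'
    simp only
    rw [geomRefl_mul_pow_single_left, sub_mul, mul_assoc 2, hm, one_mul,
      Real.sin_two_pi_sub, Real.sin_two_pi]
    simp
  have hfix (v : B →₀ ℝ) (hvi : geomForm M i v = 0) (hvj : geomForm M j v = 0) (n : ℕ) :
      ((geomRefl M j * geomRefl M i) ^ n) v = v := by
    induction n with
    | zero => simp
    | succ n ih =>
      rw [pow_succ', Module.End.mul_apply, ih, geomRefl_mul_apply, hvi, hvj]
      simp
  apply LinearMap.ext
  intro v
  set c := Real.cos (Real.pi / M i j) with hc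
  set s := Real.sin (Real.pi / M i j) with hsd
  have hcs : c ^ 2 = 1 - s ^ 2 := Real.cos_sq' _
  -- The coordinates of the component of `v` in the plane: the Gram matrix has off-diagonal entry
  -- `-c` and determinant `1 - c ^ 2 = s ^ 2`.
  set a := (geomForm M i v + c * geomForm M j v) / s ^ 2 with ha
  set b := (geomForm M j v + c * geomForm M i v) / s ^ 2 with hb
  set y : B →₀ ℝ := a • Finsupp.single i 1 + b • Finsupp.single j 1 with hy
  have hyi : geomForm M i y = geomForm M i v := by
    simp only [hy, map_add, map_smul, geomForm_self, geomForm_single, ← hc, smul_eq_mul, ha, hb]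
    field_simp
    linear_combination -(geomForm M i v) * hcs
  have hyj : geomForm M j y = geomForm M j v := by
    simp only [hy, map_add, map_smul, geomForm_self, geomForm_single, M.symmetric j i, ← hc,
      smul_eq_mul, ha, hb]
    field_simp
    linear_combination -(geomForm M j v) * hcs
  have hfy : ((geomRefl M j * geomRefl M i) ^ M i j) y = y := by
    rw [hy, map_add, map_smul, map_smul, hi, hj]
  have hfv := hfix (v - y) (by rw [map_sub, hyi, sub_self]) (by rw [map_sub, hyj, sub_self]) (M i j)
  rw [map_sub, hfy, sub_left_inj] at hfv
  exact hfv

end Geometric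

/-- The matrix entry `M i j` is the order of the product of the two simple reflections, with
the value `0` for infinite order. -/
theorem dvd_of_simple_mul_simple_pow_eq_one {i j : B} {n : ℕ}
    (h : (cs.simple i * cs.simple j) ^ n = 1) : M i j ∣ n := by
  by_cases hij : i = j
  · subst hij
    simp
  have h1 := M.off_diagonal i j hij
  have hg : (geomRefl M i * geomRefl M j) ^ n = 1 := by
    have := congrArg (cs.lift ⟨geomRefl M, isLiftable_geomRefl M⟩) h
    simpa using this
  have he := LinearMap.congr_fun hg (Finsupp.single i 1)
  rw [Module.End.one_apply] at he
  have hji := M.symmetric j i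
  by_cases h0 : M i j = 0
  · rw [geomRefl_mul_pow_single_of_eq_zero M (hji.trans h0)] at he
    have := DFunLike.congr_fun he j
    simp [hij] at this
    simp [this]
  have hs := sin_pi_div_pos h0 h1
  have he1 := geomRefl_mul_pow_single_right M j i n
  rw [he, hji] at he1
  have ei := DFunLike.congr_fun he1 i
  have ej := DFunLike.congr_fun he1 j
  simp [hij, Ne.symm hij] at ei ej
  rw [add_mul, one_mul, Real.sin_add, ← ej, zero_mul, zero_add] at ei
  -- Comparing coefficients gives `sin (2nθ) = 0` and `sin ((2n + 1)θ) = sin θ`; the addition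
  -- formula leaves `cos (2nθ) sin θ = sin θ`.
  have hcos : Real.cos (2 * n * (Real.pi / M i j)) = 1 := by
    apply mul_right_cancel₀ hs.ne'
    rw [one_mul]
    exact ei.symm
  obtain ⟨z, hz⟩ := (Real.cos_eq_one_iff _).mp hcos
  have hm : (M i j : ℝ) ≠ 0 := by exact_mod_cast h0
  have hpi := Real.pi_ne_zero
  field_simp at hz
  have : (n : ℤ) = M i j * z := by
    have : (n : ℝ) = M i j * z := by linarith
    exact_mod_cast this
  exact Int.natCast_dvd_natCast.mp ⟨z, this⟩

/-! ### Reducedness of braid words -/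

/-- The left inversions are `s_i (s_j s_i)^k` with `k < M i j`, distinct because the order of `s_j
s_i` is no smaller than `M i j`. The word is cut out of one of length `2 M i j` since the formula
for inversions is stated for even lengths. -/
theorem isReduced_take_alternatingWord (i j : B) :
    cs.IsReduced ((alternatingWord i j (2 * M i j)).take (M i j)) := by
  rw [← isReduced_reverse_iff]
  apply isReduced_of_nodup_rightInvSeq
  rw [rightInvSeq_reverse, List.nodup_reverse, leftInvSeq_take, leftInvSeq_alternatingWord_two_mul,
    ← List.map_take, List.take_range, Nat.min_eq_left (by lia)]
  have key {k l : ℕ} (hkl : k ≤ l) (hl : l < M i j)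
      (h : cs.simple i * (cs.simple j * cs.simple i) ^ k =
        cs.simple i * (cs.simple j * cs.simple i) ^ l) : k = l := by
    obtain ⟨d, rfl⟩ := Nat.exists_eq_add_of_le hkl
    rw [mul_left_cancel_iff, pow_add, left_eq_mul] at h
    have hd := cs.dvd_of_simple_mul_simple_pow_eq_one h
    rw [M.symmetric] at hd
    have := Nat.eq_zero_of_dvd_of_lt hd (by lia)
    lia
  refine List.Nodup.map_on ?_ List.nodup_range
  intro k hk l hl h
  rw [List.mem_range] at hk hl
  rcases le_total k l with hkl | hkl
  · exact key hkl hl h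
  · exact (key hkl hk h.symm).symm

theorem isReduced_braidWord (i j : B) : cs.IsReduced (braidWord M i j) := by
  by_cases h0 : M i j = 0
  · simp [braidWord, h0, alternatingWord, IsReduced]
  by_cases he : Even (M i j)
  · have := cs.isReduced_take_alternatingWord i j
    rwa [listTake_alternatingWord _ _ _ _ (by lia), if_pos he] at this
  · have := cs.isReduced_take_alternatingWord j i
    rwa [listTake_alternatingWord _ _ _ _ (by rw [M.symmetric] at h0; lia), M.symmetric j i,
      if_neg he] at this

/-- Equality of the two alternating products of length `q` means `(s_i s_j)^q = 1`, hence `M i j ∣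
q`; a reduced alternating word cannot be longer than `M i j`. -/
theorem eq_of_wordProd_alternatingWord_eq {i j : B} {q : ℕ} (hq : q ≠ 0)
    (hr : cs.IsReduced (alternatingWord i j q))
    (h : cs.wordProd (alternatingWord i j q) = cs.wordProd (alternatingWord j i q)) :
    q = M i j := by
  have hpow : (cs.simple i * cs.simple j) ^ q = 1 := by
    rw [← prod_map_alternatingWord_two_mul, ← wordProd]
    have hsplit : ∀ n, cs.wordProd (alternatingWord i j (n + q)) =
        cs.wordProd (if Even q then alternatingWord i j n else alternatingWord j i n) *
          cs.wordProd (alternatingWord i j q) := by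
      clear h hr hq
      intro n
      induction q generalizing i j with
      | zero => simp [alternatingWord]
      | succ q ih =>
        rw [← add_assoc, alternatingWord_succ, wordProd_concat, ih, alternatingWord_succ,
          wordProd_concat, mul_assoc]
        by_cases hq : Even q <;> simp [hq, Nat.even_add_one]
    rw [two_mul, hsplit]
    -- Reversal exchanges the two alternating words when `q` is even and fixes each when `q` is odd,
    -- so in both cases the two factors are mutually inverse.
    by_cases hq : Even q
    · have : alternatingWord i j q = (alternatingWord j i q).reverse := by
        obtain ⟨m, rfl⟩ := hq
        rw [← two_mul, reverse_alternatingWord_two_mul]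
      rw [if_pos hq]
      nth_rw 1 [this]
      rw [wordProd_reverse, h, inv_mul_cancel]
    · have : alternatingWord i j q = (alternatingWord i j q).reverse := by
        obtain ⟨m, rfl⟩ := Nat.not_even_iff_odd.mp hq
        rw [alternatingWord_succ, List.concat_eq_append, List.reverse_append,
          reverse_alternatingWord_two_mul, ← List.concat_eq_append, ← alternatingWord_succ,
          alternatingWord_succ']
        simp
      rw [if_neg hq, ← h]
      nth_rw 2 [this]
      rw [wordProd_reverse, mul_inv_cancel]
  have hdvd := cs.dvd_of_simple_mul_simple_pow_eq_one hpow
  have h0 : M i j ≠ 0 := fun h0 => by rw [h0, zero_dvd_iff] at hdvd; exact hq hdvd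
  apply le_antisymm _ (Nat.le_of_dvd (Nat.pos_of_ne_zero hq) hdvd)
  by_contra hlt
  exact cs.not_isReduced_alternatingWord i j h0 (not_le.mp hlt) hr

/-! ### Matsumoto's theorem -/

section Matsumoto

variable {G : Type*} [Monoid G] {f : B → G}

theorem isRightDescent_wordProd_concat {ω : List B} {i : B} (h : cs.IsReduced (ω.concat i)) :
    cs.IsRightDescent (cs.wordProd (ω.concat i)) i := by
  rw [IsRightDescent, h.eq, wordProd_concat, simple_mul_simple_cancel_right]
  simpa using Nat.lt_succ_of_le (cs.length_wordProd_le ω)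

theorem IsReduced.of_concat {cs : CoxeterSystem M W} {ω : List B} {i : B}
    (h : cs.IsReduced (ω.concat i)) : cs.IsReduced ω := by
  simpa using h.take ω.length

/-- Matsumoto's theorem: a function on the simple reflections that satisfies the braid relations
takes the same value on any two reduced words for an element. -/
theorem prod_map_eq_of_isReduced
    (hf : ∀ i j, ((braidWord M i j).map f).prod = ((braidWord M j i).map f).prod)
    {ω ω' : List B} (hω : cs.IsReduced ω) (hω' : cs.IsReduced ω')
    (h : cs.wordProd ω = cs.wordProd ω') : (ω.map f).prod = (ω'.map f).prod := by
  obtain ⟨q, hq⟩ : ∃ q, q = ω.length := ⟨_, rfl⟩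
  induction q generalizing ω ω' with
  | zero =>
    have h2 : ω'.length = 0 := by rw [← hω'.eq, ← h, hω.eq, ← hq]
    rw [List.eq_nil_of_length_eq_zero hq.symm, List.eq_nil_of_length_eq_zero h2]
  | succ q ih =>
    have hlen {x y : List B} (hx : cs.IsReduced x) (hy : cs.IsReduced y)
        (hxy : cs.wordProd x = cs.wordProd y) : x.length = y.length := by
      rw [← hx.eq, hxy, hy.eq]
    have last {x y : List B} {i : B} (hx : cs.IsReduced (x.concat i))
        (hy : cs.IsReduced (y.concat i))
        (hxy : cs.wordProd (x.concat i) = cs.wordProd (y.concat i))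
        (hl : (x.concat i).length = q + 1) :
        ((x.concat i).map f).prod = ((y.concat i).map f).prod := by
      rw [wordProd_concat, wordProd_concat, mul_left_inj] at hxy
      have := ih hx.of_concat hy.of_concat hxy (by simpa using hl.symm)
      simp [this]
    have first {x y : List B} {i : B} (hx : cs.IsReduced (i :: x))
        (hy : cs.IsReduced (i :: y))
        (hxy : cs.wordProd (i :: x) = cs.wordProd (i :: y)) (hl : (i :: x).length = q + 1) :
        ((i :: x).map f).prod = ((i :: y).map f).prod := by
      rw [wordProd_cons, wordProd_cons, mul_right_inj] at hxy
      have := ih (hx.drop 1) (hy.drop 1) hxy (by simpa using hl.symm)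
      simp only [List.drop_succ_cons, List.drop_zero] at this
      simp [this]
    by_contra hne
    -- a pair of words with different images yields one with a longer alternating suffix
    have step {x y : List B} {a j : B} (hx : cs.IsReduced (a :: x))
        (hy : cs.IsReduced (y.concat j))
        (hxy : cs.wordProd (a :: x) = cs.wordProd (y.concat j)) (hl : (a :: x).length = q + 1)
        (hn : ((a :: x).map f).prod ≠ ((y.concat j).map f).prod) :
        cs.IsReduced (x.concat j) ∧ cs.wordProd (x.concat j) = cs.wordProd (a :: x) ∧
          ((x.concat j).map f).prod ≠ ((a :: x).map f).prod := by
      have hd := cs.isRightDescent_wordProd_concat hy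
      rw [← hxy] at hd
      obtain ⟨r, hr, he⟩ := cs.exists_mul_simple_eq_eraseIdx hd
      have hprod : cs.wordProd (((a :: x).eraseIdx r).concat j) = cs.wordProd (a :: x) := by
        rw [wordProd_concat, ← he, simple_mul_simple_cancel_right]
      have hlr : (((a :: x).eraseIdx r).concat j).length = q + 1 := by
        rw [List.length_concat, List.length_eraseIdx_add_one hr, hl]
      have hred : cs.IsReduced (((a :: x).eraseIdx r).concat j) := by
        rw [IsReduced, hprod, hx.eq, hlr, hl]
      have h1 := last hred hy (hprod.trans hxy) hlr
      -- If the deleted letter is not the first, the new word shares its first letter with one given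
      -- word and its last with the other, so induction equates all images. Hence the first letter
      -- was deleted.
      rcases r with _ | r
      · rw [List.eraseIdx_cons_zero] at hprod hred h1
        exact ⟨hred, hprod, fun h => hn (h.symm.trans h1)⟩
      · exfalso
        rw [List.eraseIdx_cons_succ, List.concat_cons] at hprod hred h1 hlr
        exact hn ((first hred hx hprod hlr).symm.trans h1)
    -- The two words of a counterexample are traded until one of them ends in an alternating word of
    -- length `k + 1`, while the other ends in the letter `i` that would continue the alternation.
    have main (k : ℕ) (hk : k ≤ q) : ∃ (i j : B) (α β : List B),
        cs.IsReduced (α ++ alternatingWord i j (k + 1)) ∧ cs.IsReduced (β.concat i) ∧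
        cs.wordProd (α ++ alternatingWord i j (k + 1)) = cs.wordProd (β.concat i) ∧
        (α ++ alternatingWord i j (k + 1)).length = q + 1 ∧
        ((α ++ alternatingWord i j (k + 1)).map f).prod ≠ ((β.concat i).map f).prod := by
      induction k with
      | zero =>
        have hq' := hlen hω hω' h
        obtain ⟨α, j, rfl⟩ := List.eq_nil_or_concat ω |>.resolve_left (by rintro rfl; simp at hq)
        obtain ⟨β, i, rfl⟩ := List.eq_nil_or_concat ω' |>.resolve_left
          (by rintro rfl; rw [← hq] at hq'; simp at hq')
        refine ⟨i, j, α, β, ?_⟩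
        simp only [alternatingWord, List.concat_eq_append, List.nil_append] at *
        exact ⟨hω, hω', h, hq.symm, hne⟩
      | succ k ihk =>
        obtain ⟨i, j, α, β, h1, h2, h3, h4, h5⟩ := ihk (by lia)
        rcases α with _ | ⟨a, α⟩
        · simp at h4; lia
        rw [List.cons_append] at h1 h3 h4 h5
        obtain ⟨e1, e2, e3⟩ := step h1 h2 h3 h4 h5
        refine ⟨j, i, α, a :: (α ++ alternatingWord j i k), ?_⟩
        have e : (a :: (α ++ alternatingWord j i k)).concat j =
            a :: (α ++ alternatingWord i j (k + 1)) := by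
          simp [alternatingWord_succ]
        have e' : α ++ alternatingWord j i (k + 1 + 1) =
            (α ++ alternatingWord i j (k + 1)).concat i := by
          simp [alternatingWord_succ]
        rw [e, e']
        exact ⟨e1, h1, e2, by simp at h4 ⊢; lia, e3⟩
    -- At `k = q` the whole word is alternating. One more step compares the two alternating words of
    -- length `q + 1`, which must then be `M j i`, against the braid relation.
    obtain ⟨i, j, α, β, h1, h2, h3, h4, h5⟩ := main q le_rfl
    have hα : α = [] := by
      apply List.eq_nil_of_length_eq_zero
      simpa using h4
    subst hα
    rw [List.nil_append, alternatingWord_succ'] at h1 h3 h4 h5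
    obtain ⟨e1, e2, e3⟩ := step h1 h2 h3 h4 h5
    rw [← alternatingWord_succ'] at e2 e3 h1
    rw [← alternatingWord_succ] at e1 e2 e3
    have hm := cs.eq_of_wordProd_alternatingWord_eq (by lia) e1 e2
    rw [hm] at e3
    apply e3
    have := hf j i
    rwa [braidWord, braidWord, M.symmetric i j] at this

end Matsumoto

/-! ### The action on the free module on `F × W` -/

theorem isRightDescent_simple_mul_iff {w : W} {i j : B}
    (h : cs.simple i * w ≠ w * cs.simple j) :
    cs.IsRightDescent (cs.simple i * w) j ↔ cs.IsRightDescent w j := by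
  rw [← isLeftDescent_inv_iff, ← isLeftDescent_inv_iff, mul_inv_rev, inv_simple]
  apply isLeftDescent_mul_simple_iff
  intro h'
  apply h
  have := congrArg (fun x => w * x * w) h'
  simpa [mul_assoc] using this.symm

@[simp] theorem reflConj_coe (w : W) (t : cs.Refl) : (cs.reflConj w t).1 = w * t.1 * w⁻¹ := rfl

@[simp] theorem reflSimple_coe (i : B) : (cs.reflSimple i).1 = cs.simple i := rfl

theorem reflConj_mul (v w : W) (t : cs.Refl) :
    cs.reflConj (v * w) t = cs.reflConj v (cs.reflConj w t) :=
  Subtype.ext (by simp [mul_assoc])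

@[simp] theorem reflConj_simple_self (i : B) :
    cs.reflConj (cs.simple i) (cs.reflSimple i) = cs.reflSimple i := Subtype.ext (by simp)

/-- Operators "join with the reflection `t`" on a `W`-set, with the properties of the operators
`H ↦ ⟨H, t⟩` on reflection subgroups. -/
structure ReflJoin (F : Type*) [MulAction W F] where
  join : cs.Refl → F → F
  join_self (t : cs.Refl) (f : F) : join t (join t f) = join t f
  join_comm (t t' : cs.Refl) (f : F) : join t (join t' f) = join t' (join t f)
  join_conj (t t' : cs.Refl) (f : F) : join t (join t' f) = join t (join (cs.reflConj t.1 t') f)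
  smul_join (w : W) (t : cs.Refl) (f : F) : w • join t f = join (cs.reflConj w t) (w • f)
  refl_smul_join (t : cs.Refl) (f : F) : t.1 • join t f = join t f

namespace ReflJoin

variable {cs} {F : Type*} [MulAction W F] (J : cs.ReflJoin F) {k : Type*} [CommRing k] (u : B → k)

theorem simple_smul_join (i : B) (f : F) :
    cs.simple i • J.join (cs.reflSimple i) f = J.join (cs.reflSimple i) f :=
  J.refl_smul_join (cs.reflSimple i) f

theorem join_simple_smul (i : B) (f : F) :
    J.join (cs.reflSimple i) (cs.simple i • f) = J.join (cs.reflSimple i) f := by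
  rw [← J.simple_smul_join i f, J.smul_join, reflConj_simple_self]

variable (F W k) in
/-- The free module on `F × W`. -/
abbrev Mod : Type _ := (F × W) →₀ k

variable (k) in
/-- The standard basis vector, which stands for the product `e_f g_w`. -/
noncomputable def vec (f : F) (w : W) : Mod W F k := Finsupp.single (f, w) 1

omit [Group W] [MulAction W F] in
theorem ext_vec {N : Type*} [AddCommMonoid N] [Module k N] {A A' : Mod W F k →ₗ[k] N}
    (h : ∀ f w, A (vec k f w) = A' (vec k f w)) : A = A' := by
  apply Finsupp.lhom_ext'
  rintro ⟨f, w⟩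
  ext1
  exact h f w

/-- Left multiplication by `e_t`. -/
noncomputable def opE (t : cs.Refl) : Module.End k (Mod W F k) :=
  Finsupp.linearCombination k fun x : F × W => vec k (J.join t x.1) x.2

open Classical in
/-- Left multiplication by `g_s`. -/
noncomputable def opL (i : B) : Module.End k (Mod W F k) :=
  Finsupp.linearCombination k fun x : F × W =>
    vec k (cs.simple i • x.1) (cs.simple i * x.2) +
      if cs.IsLeftDescent x.2 i then
        (u i - 1) • (vec k (J.join (cs.reflSimple i) x.1) (cs.simple i * x.2) +
          vec k (J.join (cs.reflSimple i) x.1) x.2)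
      else 0

open Classical in
/-- Right multiplication by `g_s`. -/
noncomputable def opR (j : B) : Module.End k (Mod W F k) :=
  Finsupp.linearCombination k fun x : F × W =>
    vec k x.1 (x.2 * cs.simple j) +
      if cs.IsRightDescent x.2 j then
        (u j - 1) • (vec k (J.join (cs.reflConj x.2 (cs.reflSimple j)) x.1) (x.2 * cs.simple j) +
          vec k (J.join (cs.reflConj x.2 (cs.reflSimple j)) x.1) x.2)
      else 0

theorem opE_vec (t : cs.Refl) (f : F) (w : W) :
    J.opE t (vec k f w) = vec k (J.join t f) w := by
  simp [opE, vec]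

open Classical in
theorem opL_vec (i : B) (f : F) (w : W) :
    J.opL u i (vec k f w) = vec k (cs.simple i • f) (cs.simple i * w) +
      if cs.IsLeftDescent w i then
        (u i - 1) • (vec k (J.join (cs.reflSimple i) f) (cs.simple i * w) +
          vec k (J.join (cs.reflSimple i) f) w)
      else 0 := by
  rw [opL, vec, Finsupp.linearCombination_single, one_smul]

open Classical in
theorem opR_vec (j : B) (f : F) (w : W) :
    J.opR u j (vec k f w) = vec k f (w * cs.simple j) +
      if cs.IsRightDescent w j then
        (u j - 1) • (vec k (J.join (cs.reflConj w (cs.reflSimple j)) f) (w * cs.simple j) +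
          vec k (J.join (cs.reflConj w (cs.reflSimple j)) f) w)
      else 0 := by
  rw [opR, vec, Finsupp.linearCombination_single, one_smul]

theorem opL_vec_of_not_isLeftDescent {i : B} {w : W} (h : ¬cs.IsLeftDescent w i) (f : F) :
    J.opL u i (vec k f w) = vec k (cs.simple i • f) (cs.simple i * w) := by
  rw [opL_vec, if_neg h, add_zero]

theorem opR_vec_of_not_isRightDescent {j : B} {w : W} (h : ¬cs.IsRightDescent w j) (f : F) :
    J.opR u j (vec k f w) = vec k f (w * cs.simple j) := by
  rw [opR_vec, if_neg h, add_zero]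

theorem opE_mul_self (t : cs.Refl) : J.opE (k := k) t * J.opE t = J.opE t :=
  ext_vec fun f w => by simp only [Module.End.mul_apply, opE_vec, J.join_self]

theorem opE_comm (t t' : cs.Refl) : J.opE (k := k) t * J.opE t' = J.opE t' * J.opE t :=
  ext_vec fun f w => by simp only [Module.End.mul_apply, opE_vec, J.join_comm t t']

theorem opE_conj (t t' : cs.Refl) :
    J.opE (k := k) t * J.opE t' = J.opE t * J.opE (cs.reflConj t.1 t') :=
  ext_vec fun f w => by
    simp only [Module.End.mul_apply, opE_vec]
    rw [J.join_comm, J.join_comm _ t, ← J.join_conj, J.join_comm]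

theorem opL_mul_opE (i : B) (t : cs.Refl) :
    J.opL u i * J.opE t = J.opE (cs.reflConj (cs.simple i) t) * J.opL u i :=
  ext_vec fun f w => by
    have h (f : F) : J.join (cs.reflConj (cs.simple i) t) (J.join (cs.reflSimple i) f) =
        J.join (cs.reflSimple i) (J.join t f) := by
      rw [J.join_comm, J.join_conj (cs.reflSimple i) t]; rfl
    by_cases hD : cs.IsLeftDescent w i
    · simp only [Module.End.mul_apply, opE_vec, opL_vec, if_pos hD, map_add, map_smul, h,
        J.smul_join]
    · simp only [Module.End.mul_apply, opE_vec, opL_vec, if_neg hD, J.smul_join, add_zero]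

theorem opL_mul_self (i : B) : J.opL u i * J.opL u i =
    1 + (u i - 1) • (J.opE (cs.reflSimple i) * (1 + J.opL u i)) :=
  ext_vec fun f w => by
    have hi := cs.isLeftDescent_iff_not_isLeftDescent_mul (w := w) (i := i)
    by_cases hD : cs.IsLeftDescent w i
    · have hD' := hi.mp hD
      simp only [Module.End.mul_apply, opE_vec, opL_vec, if_pos hD, if_neg hD', map_add, map_smul,
        LinearMap.add_apply, LinearMap.smul_apply, Module.End.one_apply, J.simple_smul_join,
        J.join_simple_smul, J.join_self, simple_mul_simple_cancel_left, smul_smul,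
        simple_mul_simple_self, one_smul]
      module
    · have hD' := not_not.mp (mt hi.mpr hD)
      simp only [Module.End.mul_apply, opE_vec, opL_vec, if_neg hD, if_pos hD', map_add,
        LinearMap.add_apply, LinearMap.smul_apply, Module.End.one_apply,
        J.join_simple_smul, simple_mul_simple_cancel_left, smul_smul,
        simple_mul_simple_self, one_smul, add_zero]

/-- If `s_i w ≠ w s_j`, neither multiplication affects the descent on the other side, and the
correction terms match. If `s_i w = w s_j`, both sides join the same reflection `s_i = w s_j w⁻¹`,
and `u i = u j` because `s_i` and `s_j` are conjugate. -/
theorem opL_comm_opR (hu : ∀ i j : B, IsConj (cs.simple i) (cs.simple j) → u i = u j) (i j : B) :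
    Commute (J.opL u i) (J.opR u j) :=
  ext_vec fun f w => by
    have hL := cs.isLeftDescent_iff_not_isLeftDescent_mul (w := w) (i := i)
    have hR := cs.isRightDescent_iff_not_isRightDescent_mul (w := w) (i := j)
    by_cases h : cs.simple i * w = w * cs.simple j
    · have hr : cs.reflConj w (cs.reflSimple j) = cs.reflSimple i := Subtype.ext (by
        simp [← h])
      have huij : u i = u j := (hu j i (isConj_iff.mpr ⟨w, congrArg Subtype.val hr⟩)).symm
      have hRL : cs.IsRightDescent w j ↔ cs.IsLeftDescent w i := by
        rw [IsRightDescent, IsLeftDescent, h]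
      rw [h] at hL
      rw [← h] at hR
      have hr' : cs.reflConj (w * cs.simple j) (cs.reflSimple j) = cs.reflSimple i := by
        rw [reflConj_mul, reflConj_simple_self, hr]
      have h' : cs.simple i * (w * cs.simple j) = w := by
        rw [← h, simple_mul_simple_cancel_left]
      by_cases hD : cs.IsLeftDescent w i
      · have hD' := hL.mp hD
        have hE := hRL.mpr hD
        have hE' := hR.mp hE
        rw [h] at hE'
        simp only [Module.End.mul_apply, opR_vec, opL_vec, h, h', if_pos hD, if_neg hD', if_pos hE,
          if_neg hE', map_add, map_smul, hr, hr', J.join_simple_smul, J.simple_smul_join,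
          simple_mul_simple_cancel_right, J.join_self, huij]
      · have hD' := not_not.mp (mt hL.mpr hD)
        have hE := mt hRL.mp hD
        have hE' := not_not.mp (mt hR.mpr hE)
        rw [h] at hE'
        simp only [Module.End.mul_apply, opR_vec, opL_vec, h, h', if_neg hD, if_pos hD', if_neg hE,
          if_pos hE', hr', J.join_simple_smul, simple_mul_simple_cancel_right, huij,
          add_zero]
    · have hL' := cs.isLeftDescent_mul_simple_iff h
      have hR' := cs.isRightDescent_simple_mul_iff h
      -- After joining `s_i`, joining a reflection or its conjugate by `s_i` gives the same result.
      have hj (f : F) : J.join (cs.reflConj (cs.simple i) (cs.reflConj w (cs.reflSimple j)))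
          (J.join (cs.reflSimple i) f) =
          J.join (cs.reflSimple i) (J.join (cs.reflConj w (cs.reflSimple j)) f) := by
        rw [J.join_comm, J.join_conj (cs.reflSimple i) (cs.reflConj w (cs.reflSimple j))]; rfl
      have hj' (f : F) : J.join (cs.reflConj w (cs.reflSimple j)) (J.join (cs.reflSimple i) f) =
          J.join (cs.reflSimple i) (J.join (cs.reflConj w (cs.reflSimple j)) f) := J.join_comm _ _ _
      by_cases hD : cs.IsLeftDescent w i <;> by_cases hE : cs.IsRightDescent w j <;>
      · simp only [Module.End.mul_apply, opR_vec, opL_vec, hL', hR', hD, hE, if_true, if_false,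
          map_add, map_smul, reflConj_mul, J.smul_join, hj, hj', mul_assoc, add_zero]
        try module

/-- The action of `g_{s₁} ⋯ g_{sₙ}` for a word. -/
noncomputable def opWord (ω : List B) : Module.End k (Mod W F k) := (ω.map (J.opL u)).prod

/-- Along a reduced word each letter lengthens the element, so no correction term arises. -/
theorem opWord_vec_one {ω : List B} (hω : cs.IsReduced ω) (f : F) :
    J.opWord u ω (vec k f 1) = vec k (cs.wordProd ω • f) (cs.wordProd ω) := by
  induction ω with
  | nil => simp [opWord]
  | cons i ω ih =>
    have hω' : cs.IsReduced ω := by simpa using hω.drop 1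
    have : ¬cs.IsLeftDescent (cs.wordProd ω) i := by
      rw [not_isLeftDescent_iff, ← wordProd_cons, hω.eq, hω'.eq, List.length_cons]
    rw [opWord] at ih ⊢
    rw [List.map_cons, List.prod_cons, Module.End.mul_apply, ih hω',
      J.opL_vec_of_not_isLeftDescent u this, wordProd_cons, mul_smul]

theorem opWord_comm_opR (hu : ∀ i j : B, IsConj (cs.simple i) (cs.simple j) → u i = u j)
    (ω : List B) (j : B) : Commute (J.opWord u ω) (J.opR u j) := by
  apply Commute.list_prod_left
  intro x hx
  obtain ⟨i, -, rfl⟩ := List.mem_map.mp hx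
  exact J.opL_comm_opR u hu i j

/-- Along a reduced word for `w` the right operators carry `(f, 1)` to `(f, w)` without correction
terms, so an operator that commutes with them is determined by its values on the `(f, 1)`. -/
theorem eq_of_comm_opR {A A' : Module.End k (Mod W F k)} (hA : ∀ j, Commute A (J.opR u j))
    (hA' : ∀ j, Commute A' (J.opR u j)) (h : ∀ f, A (vec k f 1) = A' (vec k f 1)) : A = A' := by
  apply ext_vec
  intro f w
  obtain ⟨ω, hω, rfl⟩ := cs.exists_isReduced w
  induction ω using List.reverseRecOn with
  | nil => simpa using h f
  | append_singleton ω j ih =>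
    rw [← List.concat_eq_append] at hω ⊢
    have hω' := hω.of_concat
    have hn : ¬cs.IsRightDescent (cs.wordProd ω) j := by
      rw [not_isRightDescent_iff, ← wordProd_concat, hω.eq, hω'.eq, List.length_concat]
    have e := J.opR_vec_of_not_isRightDescent u hn f
    rw [wordProd_concat, ← e, ← Module.End.mul_apply, ← Module.End.mul_apply, hA j, hA' j,
      Module.End.mul_apply, Module.End.mul_apply, ih hω']

theorem opWord_braidWord (hu : ∀ i j : B, IsConj (cs.simple i) (cs.simple j) → u i = u j)
    (i j : B) : J.opWord u (braidWord M i j) = J.opWord u (braidWord M j i) := by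
  apply J.eq_of_comm_opR u (J.opWord_comm_opR u hu _) (J.opWord_comm_opR u hu _)
  intro f
  rw [J.opWord_vec_one u (cs.isReduced_braidWord i j), J.opWord_vec_one u (cs.isReduced_braidWord j i),
    cs.wordProd_braidWord_eq]

/-- The action of the free algebra. -/
noncomputable def repFree : FreeAlgebra k cs.ExtHeckeGen →ₐ[k] Module.End k (Mod W F k) :=
  FreeAlgebra.lift k fun
    | ExtHeckeGen.g i => J.opL u i
    | ExtHeckeGen.e t => J.opE t

theorem repFree_g (i : B) : J.repFree u (FreeAlgebra.ι k (ExtHeckeGen.g i)) = J.opL u i := by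
  rw [repFree, FreeAlgebra.lift_ι_apply]

theorem repFree_e (t : cs.Refl) : J.repFree u (FreeAlgebra.ι k (ExtHeckeGen.e t)) = J.opE t := by
  rw [repFree, FreeAlgebra.lift_ι_apply]

theorem repFree_gWordFree (ω : List B) : J.repFree u (cs.gWordFree k ω) = J.opWord u ω := by
  rw [gWordFree, map_list_prod, List.map_map, opWord]
  congr 2
  funext i
  exact J.repFree_g u i

theorem repFree_rel (hu : ∀ i j : B, IsConj (cs.simple i) (cs.simple j) → u i = u j)
    ⦃x y : FreeAlgebra k cs.ExtHeckeGen⦄ (h : cs.ExtHeckeRel u x y) :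
    J.repFree u x = J.repFree u y := by
  cases h with
  | braid i j => rw [repFree_gWordFree, repFree_gWordFree, J.opWord_braidWord u hu]
  | idem t => rw [map_mul, repFree_e, opE_mul_self]
  | comm t t' => rw [map_mul, map_mul, repFree_e, repFree_e, opE_comm]
  | conj t t' => rw [map_mul, map_mul, repFree_e, repFree_e, repFree_e, opE_conj]
  | ge i t => rw [map_mul, map_mul, repFree_e, repFree_e, repFree_g, opL_mul_opE]
  | quad i =>
    rw [map_mul, map_add, map_smul, map_mul, map_add, map_one, repFree_e, repFree_g, opL_mul_self]

/-- The action of `C_W(u)` on the free module on `F × W`. -/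
noncomputable def rep (hu : ∀ i j : B, IsConj (cs.simple i) (cs.simple j) → u i = u j) :
    cs.ExtHecke u →ₐ[k] Module.End k (Mod W F k) :=
  RingQuot.liftAlgHom k ⟨J.repFree u, J.repFree_rel u hu⟩

variable (hu : ∀ i j : B, IsConj (cs.simple i) (cs.simple j) → u i = u j)

theorem rep_g (i : B) : J.rep u hu (ExtHecke.g cs u i) = J.opL u i := by
  rw [rep, ExtHecke.g, RingQuot.liftAlgHom_mkAlgHom_apply, repFree_g]

theorem rep_e (t : cs.Refl) : J.rep u hu (ExtHecke.e cs u t) = J.opE t := by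
  rw [rep, ExtHecke.e, RingQuot.liftAlgHom_mkAlgHom_apply, repFree_e]

end ReflJoin

/-! ### Joining reflections to reflection subgroups, modulo `p` -/

section Subgroups

theorem exists_reflSpan_eq (H : cs.FGReflSubgroup) : ∃ J, cs.reflSpan J = H := by
  obtain ⟨H, J, rfl⟩ := H
  exact ⟨J, rfl⟩

open Classical in
/-- The subgroup `⟨H, t⟩` generated by a finitely generated reflection subgroup `H` and
a reflection `t`. -/
noncomputable def adjoinRefl (H : cs.FGReflSubgroup) (t : cs.Refl) : cs.FGReflSubgroup :=
  ⟨H.1 ⊔ Subgroup.closure {t.1}, by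
    obtain ⟨J, hJ⟩ := H.2
    refine ⟨J ∪ {t}, ?_⟩
    rw [← hJ, ← Subgroup.closure_union, Finset.coe_union, Set.image_union, Finset.coe_singleton,
      Set.image_singleton]⟩

theorem adjoinRefl_coe (H : cs.FGReflSubgroup) (t : cs.Refl) :
    (cs.adjoinRefl H t).1 = H.1 ⊔ Subgroup.closure {t.1} := rfl

theorem smul_coe (w : W) (H : cs.FGReflSubgroup) :
    (w • H).1 = H.1.map (MulAut.conj w).toMonoidHom := rfl

theorem adjoinRefl_reflSimple (H : cs.FGReflSubgroup) (i : B) :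
    cs.adjoinRefl H (cs.reflSimple i) = cs.adjoinSimple H i := rfl

theorem smul_adjoinRefl (w : W) (H : cs.FGReflSubgroup) (t : cs.Refl) :
    w • cs.adjoinRefl H t = cs.adjoinRefl (w • H) (cs.reflConj w t) := by
  apply Subtype.ext
  rw [smul_coe, adjoinRefl_coe, adjoinRefl_coe, smul_coe, Subgroup.map_sup,
    MonoidHom.map_closure, Set.image_singleton]
  rfl

theorem closure_sup_closure_conj (t t' : W) :
    Subgroup.closure {t} ⊔ Subgroup.closure {t'} =
      Subgroup.closure {t} ⊔ Subgroup.closure {t * t' * t⁻¹} := by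
  have ht (K : Subgroup W) : t ∈ Subgroup.closure {t} ⊔ K :=
    (le_sup_left : _ ≤ Subgroup.closure {t} ⊔ K) (Subgroup.subset_closure rfl)
  have ht' (r : W) : r ∈ Subgroup.closure {t} ⊔ Subgroup.closure {r} :=
    (le_sup_right : _ ≤ Subgroup.closure {t} ⊔ _) (Subgroup.subset_closure rfl)
  apply le_antisymm
  · refine sup_le le_sup_left ?_
    rw [Subgroup.closure_le, Set.singleton_subset_iff]
    have := mul_mem (mul_mem (inv_mem (ht _)) (ht' (t * t' * t⁻¹))) (ht _)
    simpa [mul_assoc] using this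
  · refine sup_le le_sup_left ?_
    rw [Subgroup.closure_le, Set.singleton_subset_iff]
    exact mul_mem (mul_mem (ht _) (ht' _)) (inv_mem (ht _))

theorem refl_smul_adjoinRefl (H : cs.FGReflSubgroup) (t : cs.Refl) :
    t.1 • cs.adjoinRefl H t = cs.adjoinRefl H t := by
  apply Subtype.ext
  have ht : t.1 ∈ (cs.adjoinRefl H t).1 :=
    (le_sup_right : _ ≤ H.1 ⊔ Subgroup.closure {t.1}) (Subgroup.subset_closure rfl)
  exact Subgroup.conj_smul_eq_self_of_mem ht

open Classical in
theorem adjoinRefl_reflSpan (J : Finset cs.Refl) (t : cs.Refl) :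
    cs.adjoinRefl (cs.reflSpan J) t = cs.reflSpan (insert t J) := by
  apply Subtype.ext
  simp only [adjoinRefl, reflSpan]
  rw [← Subgroup.closure_union, Finset.coe_insert, Set.image_insert_eq, Set.union_singleton]

open Classical in
theorem smul_reflSpan (w : W) (J : Finset cs.Refl) :
    w • cs.reflSpan J = cs.reflSpan (J.image (cs.reflConj w)) := by
  apply Subtype.ext
  rw [smul_coe]
  simp only [reflSpan]
  rw [MonoidHom.map_closure, Finset.coe_image, Set.image_image, Set.image_image]
  rfl

variable {F : Type*} [MulAction W F] {p : cs.FGReflSubgroup → F}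
  (hp_surj : Function.Surjective p)
  (hp_equiv : ∀ (w : W) (H : cs.FGReflSubgroup), p (w • H) = w • p H)
  (hp_adjoin : ∀ H K : cs.FGReflSubgroup, p H = p K →
      ∀ i : B, p (cs.adjoinSimple H i) = p (cs.adjoinSimple K i))

-- With `t = w s w⁻¹` one has `⟨H, t⟩ = w • ⟨w⁻¹ • H, s⟩`, so equivariance reduces compatibility
-- with any reflection to the case of simple ones.
include hp_equiv hp_adjoin in
theorem map_adjoinRefl_eq {H K : cs.FGReflSubgroup} (h : p H = p K) (t : cs.Refl) :
    p (cs.adjoinRefl H t) = p (cs.adjoinRefl K t) := by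
  obtain ⟨t, w, i, rfl⟩ := t
  have key (H : cs.FGReflSubgroup) : cs.adjoinRefl H ⟨w * cs.simple i * w⁻¹, w, i, rfl⟩ =
      w • cs.adjoinSimple (w⁻¹ • H) i := by
    rw [← adjoinRefl_reflSimple, smul_adjoinRefl, smul_inv_smul]
    rfl
  rw [key, key, hp_equiv, hp_equiv]
  congr 1
  apply hp_adjoin
  rw [hp_equiv, hp_equiv, h]

include hp_equiv hp_adjoin in
open Classical in
theorem map_reflSpan_union_eq {J K : Finset cs.Refl} (h : p (cs.reflSpan J) = p (cs.reflSpan K))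
    (L : Finset cs.Refl) : p (cs.reflSpan (J ∪ L)) = p (cs.reflSpan (K ∪ L)) := by
  induction L using Finset.induction_on with
  | empty => simpa using h
  | insert t L _ ih =>
    rw [Finset.union_insert, Finset.union_insert, ← adjoinRefl_reflSpan, ← adjoinRefl_reflSpan]
    exact cs.map_adjoinRefl_eq hp_equiv hp_adjoin ih t

include hp_equiv hp_adjoin in
theorem map_adjoinRefl_surjInv (t : cs.Refl) (H : cs.FGReflSubgroup) :
    p (cs.adjoinRefl (Function.surjInv hp_surj (p H)) t) = p (cs.adjoinRefl H t) :=
  cs.map_adjoinRefl_eq hp_equiv hp_adjoin (Function.surjInv_eq hp_surj _) t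

/-- The operators `p H ↦ p ⟨H, t⟩`. -/
noncomputable def reflJoin : cs.ReflJoin F where
  -- The choice of a preimage of `f` is immaterial, by `map_adjoinRefl_eq`.
  join t f := p (cs.adjoinRefl (Function.surjInv hp_surj f) t)
  join_self t f := by
    obtain ⟨H, rfl⟩ := hp_surj f
    simp only [cs.map_adjoinRefl_surjInv hp_surj hp_equiv hp_adjoin]
    congr 1
    apply Subtype.ext
    simp only [adjoinRefl_coe, sup_assoc, sup_idem]
  join_comm t t' f := by
    obtain ⟨H, rfl⟩ := hp_surj f
    simp only [cs.map_adjoinRefl_surjInv hp_surj hp_equiv hp_adjoin]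
    congr 1
    apply Subtype.ext
    simp only [adjoinRefl_coe, sup_right_comm]
  join_conj t t' f := by
    obtain ⟨H, rfl⟩ := hp_surj f
    simp only [cs.map_adjoinRefl_surjInv hp_surj hp_equiv hp_adjoin]
    congr 1
    apply Subtype.ext
    simp only [adjoinRefl_coe, sup_assoc, reflConj_coe]
    rw [sup_comm (Subgroup.closure {t'.1}), closure_sup_closure_conj, sup_comm]
    rw [sup_comm (Subgroup.closure {t.1}), sup_comm]
  smul_join w t f := by
    obtain ⟨H, rfl⟩ := hp_surj f
    rw [← hp_equiv w H]
    simp only [cs.map_adjoinRefl_surjInv hp_surj hp_equiv hp_adjoin]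
    rw [← hp_equiv, smul_adjoinRefl]
  refl_smul_join t f := by
    rw [← hp_equiv, refl_smul_adjoinRefl]

theorem reflJoin_join (t : cs.Refl) (H : cs.FGReflSubgroup) :
    (cs.reflJoin hp_surj hp_equiv hp_adjoin).join t (p H) = p (cs.adjoinRefl H t) :=
  cs.map_adjoinRefl_surjInv hp_surj hp_equiv hp_adjoin t H

end Subgroups

/-! ### The elements `g_w` and `e_J` of the algebra -/

namespace ExtHecke

variable {k : Type*} [CommRing k] (u : B → k)

theorem e_mul_self (t : cs.Refl) : e cs u t * e cs u t = e cs u t := by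
  have h := RingQuot.mkAlgHom_rel k (ExtHeckeRel.idem (cs := cs) (u := u) t)
  rwa [map_mul] at h

theorem g_mul_e (i : B) (t : cs.Refl) :
    g cs u i * e cs u t = e cs u (cs.reflConj (cs.simple i) t) * g cs u i := by
  have h := RingQuot.mkAlgHom_rel k (ExtHeckeRel.ge (cs := cs) (u := u) i t)
  rwa [map_mul, map_mul] at h

theorem g_mul_self (i : B) : g cs u i * g cs u i =
    1 + (u i - 1) • (e cs u (cs.reflSimple i) * (1 + g cs u i)) := by
  have h := RingQuot.mkAlgHom_rel k (ExtHeckeRel.quad (cs := cs) (u := u) i)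
  rwa [map_mul, map_add, map_smul, map_mul, map_add, map_one] at h

/-- Product of the generators `g` along a word. -/
noncomputable def gWord (ω : List B) : cs.ExtHecke u := (ω.map (g cs u)).prod

theorem gWord_eq (ω : List B) :
    gWord cs u ω = RingQuot.mkAlgHom k (cs.ExtHeckeRel u) (cs.gWordFree k ω) := by
  rw [gWordFree, map_list_prod, List.map_map, gWord]
  rfl

theorem gWord_eq_of_isReduced {ω ω' : List B} (hω : cs.IsReduced ω) (hω' : cs.IsReduced ω')
    (h : cs.wordProd ω = cs.wordProd ω') : gWord cs u ω = gWord cs u ω' := by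
  refine cs.prod_map_eq_of_isReduced (fun i j => ?_) hω hω' h
  change gWord cs u _ = gWord cs u _
  rw [gWord_eq, gWord_eq]
  exact RingQuot.mkAlgHom_rel k (ExtHeckeRel.braid i j)

/-- The element `g_w`. -/
noncomputable def gElem (w : W) : cs.ExtHecke u := gWord cs u (cs.exists_isReduced w).choose

theorem gElem_wordProd {ω : List B} (hω : cs.IsReduced ω) :
    gElem cs u (cs.wordProd ω) = gWord cs u ω :=
  have h := (cs.exists_isReduced (cs.wordProd ω)).choose_spec
  gWord_eq_of_isReduced cs u h.1 hω h.2.symm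

theorem gElem_one : gElem cs u (1 : W) = 1 := by
  rw [← cs.wordProd_nil, gElem_wordProd cs u (by simp [IsReduced])]
  simp [gWord]

theorem g_mul_gElem {i : B} {w : W} (h : ¬cs.IsLeftDescent w i) :
    g cs u i * gElem cs u w = gElem cs u (cs.simple i * w) := by
  obtain ⟨ω, hω, rfl⟩ := cs.exists_isReduced w
  rw [not_isLeftDescent_iff, hω.eq, ← wordProd_cons] at h
  rw [← wordProd_cons, gElem_wordProd cs u h, gElem_wordProd cs u hω]
  simp [gWord]

open Classical in
theorem eProd_insert (t : cs.Refl) (J : Finset cs.Refl) :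
    eProd cs u (insert t J) = e cs u t * eProd cs u J := by
  have h (J : Finset cs.Refl) (ht : t ∉ J) :
      eProd cs u (insert t J) = e cs u t * eProd cs u J :=
    Finset.noncommProd_insert_of_notMem _ _ _ _ ht
  by_cases ht : t ∈ J
  · rw [Finset.insert_eq_of_mem ht, ← Finset.insert_erase ht, h _ (Finset.notMem_erase t J),
      ← mul_assoc, e_mul_self]
  · exact h J ht

theorem eProd_empty : eProd cs u ∅ = 1 := Finset.noncommProd_empty _ _

open Classical in
theorem g_mul_eProd (i : B) (J : Finset cs.Refl) : g cs u i * eProd cs u J =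
    eProd cs u (J.image (cs.reflConj (cs.simple i))) * g cs u i := by
  induction J using Finset.induction_on with
  | empty => simp [eProd_empty]
  | insert t J _ ih =>
    rw [Finset.image_insert, eProd_insert, eProd_insert, ← mul_assoc, g_mul_e, mul_assoc, ih,
      mul_assoc]

theorem toIwahoriHecke_g (i : B) : toIwahoriHecke cs u (g cs u i) = IwahoriHecke.T M u i := by
  rw [toIwahoriHecke, g, RingQuot.liftAlgHom_mkAlgHom_apply, toIwahoriHeckeFree_g]

theorem toIwahoriHecke_e (t : cs.Refl) : toIwahoriHecke cs u (e cs u t) = 1 := by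
  rw [toIwahoriHecke, e, RingQuot.liftAlgHom_mkAlgHom_apply, toIwahoriHeckeFree_e]

theorem toIwahoriHecke_eProd (J : Finset cs.Refl) : toIwahoriHecke cs u (eProd cs u J) = 1 := by
  classical
  induction J using Finset.induction_on with
  | empty => rw [eProd_empty, map_one]
  | insert t J _ ih => rw [eProd_insert, map_mul, ih, toIwahoriHecke_e, one_mul]

theorem toIwahoriHecke_surjective : Function.Surjective (toIwahoriHecke cs u) := by
  intro x
  obtain ⟨x, rfl⟩ := RingQuot.mkAlgHom_surjective k (IwahoriHeckeRel M u) x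
  rw [← AlgHom.mem_range]
  induction x using FreeAlgebra.induction with
  | grade0 r => rw [AlgHom.commutes]; exact Subalgebra.algebraMap_mem _ r
  | grade1 i => exact ⟨g cs u i, toIwahoriHecke_g cs u i⟩
  | mul a b ha hb => rw [map_mul]; exact mul_mem ha hb
  | add a b ha hb => rw [map_add]; exact add_mem ha hb

/-! ### The quotient by `I_p` and its universal property -/

variable {F : Type*} (p : cs.FGReflSubgroup → F)

theorem map_eq_of_ringCon {A : Type*} [Semiring A] [Algebra k A] (φ : cs.ExtHecke u →ₐ[k] A)
    (h : ∀ J K : Finset cs.Refl, p (cs.reflSpan J) = p (cs.reflSpan K) →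
      φ (eProd cs u J) = φ (eProd cs u K)) :
    (idealOf cs u p).ringCon ≤ RingCon.ker φ.toRingHom := by
  refine RingCon.ringConGen_le.mpr ?_
  rintro x y ⟨J, K, hJK, hxy⟩
  have h0 : φ (eProd cs u J - eProd cs u K) = 0 := by
    rw [sub_eq_add_neg, map_add, h J K hJK, ← map_add, add_neg_cancel, map_zero]
  have hx : φ x = φ y := by
    rw [← sub_add_cancel x y, hxy, map_add, h0, zero_add]
  exact hx

variable {p} in
/-- A morphism that identifies `e_J` and `e_K` whenever `p ⟨J⟩ = p ⟨K⟩` factors through the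
quotient. -/
noncomputable def quotLift {A : Type*} [Semiring A] [Algebra k A] (φ : cs.ExtHecke u →ₐ[k] A)
    (h : ∀ J K : Finset cs.Refl, p (cs.reflSpan J) = p (cs.reflSpan K) →
      φ (eProd cs u J) = φ (eProd cs u K)) : QuotBy cs u p →ₐ[k] A :=
  RingCon.liftₐ (idealOf cs u p).ringCon φ (map_eq_of_ringCon cs u p φ h)

variable {p} in
theorem quotLift_quotByMk {A : Type*} [Semiring A] [Algebra k A] (φ : cs.ExtHecke u →ₐ[k] A)
    (h : ∀ J K : Finset cs.Refl, p (cs.reflSpan J) = p (cs.reflSpan K) →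
      φ (eProd cs u J) = φ (eProd cs u K)) (x : cs.ExtHecke u) :
    quotLift cs u φ h (quotByMk cs u p x) = φ x := rfl

theorem quotByMk_eProd_eq {J K : Finset cs.Refl} (h : p (cs.reflSpan J) = p (cs.reflSpan K)) :
    quotByMk cs u p (eProd cs u J) = quotByMk cs u p (eProd cs u K) := by
  apply (RingCon.eq _).mpr
  rw [TwoSidedIdeal.rel_iff]
  exact TwoSidedIdeal.subset_span ⟨J, K, h, rfl⟩

variable {p} (hp_surj : Function.Surjective p)

include hp_surj in
theorem exists_map_reflSpan_eq (f : F) : ∃ J : Finset cs.Refl, p (cs.reflSpan J) = f := by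
  obtain ⟨H, rfl⟩ := hp_surj f
  obtain ⟨J, rfl⟩ := cs.exists_reflSpan_eq H
  exact ⟨J, rfl⟩

/-- The image in the quotient of `e_J`, for any `J` with `p ⟨J⟩ = f`. -/
noncomputable def eElem (f : F) : QuotBy cs u p :=
  quotByMk cs u p (eProd cs u (exists_map_reflSpan_eq cs hp_surj f).choose)

theorem eElem_map_reflSpan (J : Finset cs.Refl) :
    eElem cs u hp_surj (p (cs.reflSpan J)) = quotByMk cs u p (eProd cs u J) :=
  quotByMk_eProd_eq cs u p (exists_map_reflSpan_eq cs hp_surj _).choose_spec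

/-! ### The quotient and the free module on `F × W` are isomorphic -/

/-- The linear map from the free module on `F × W` to the quotient, `(f, w) ↦ e_f g_w`. -/
noncomputable def ofMod : ReflJoin.Mod W F k →ₗ[k] QuotBy cs u p :=
  Finsupp.linearCombination k fun x : F × W =>
    eElem cs u hp_surj x.1 * quotByMk cs u p (gElem cs u x.2)

theorem ofMod_vec (f : F) (w : W) : ofMod cs u hp_surj (ReflJoin.vec k f w) =
    eElem cs u hp_surj f * quotByMk cs u p (gElem cs u w) := by
  rw [ofMod, ReflJoin.vec, Finsupp.linearCombination_single, one_smul]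

variable [MulAction W F]
  (hp_equiv : ∀ (w : W) (H : cs.FGReflSubgroup), p (w • H) = w • p H)
  (hp_adjoin : ∀ H K : cs.FGReflSubgroup, p H = p K →
      ∀ i : B, p (cs.adjoinSimple H i) = p (cs.adjoinSimple K i))
  (hu : ∀ i j : B, IsConj (cs.simple i) (cs.simple j) → u i = u j)

theorem e_mul_eElem (t : cs.Refl) (f : F) :
    quotByMk cs u p (e cs u t) * eElem cs u hp_surj f =
      eElem cs u hp_surj ((cs.reflJoin hp_surj hp_equiv hp_adjoin).join t f) := by
  classical
  obtain ⟨J, rfl⟩ := exists_map_reflSpan_eq cs hp_surj f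
  rw [reflJoin_join, adjoinRefl_reflSpan, eElem_map_reflSpan, eElem_map_reflSpan, eProd_insert,
    map_mul]

include hp_equiv in
theorem g_mul_eElem (i : B) (f : F) :
    quotByMk cs u p (g cs u i) * eElem cs u hp_surj f =
      eElem cs u hp_surj (cs.simple i • f) * quotByMk cs u p (g cs u i) := by
  classical
  obtain ⟨J, rfl⟩ := exists_map_reflSpan_eq cs hp_surj f
  rw [← hp_equiv, smul_reflSpan, eElem_map_reflSpan, eElem_map_reflSpan, ← map_mul, g_mul_eProd,
    map_mul]

theorem ofMod_opE (t : cs.Refl) (v : ReflJoin.Mod W F k) :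
    ofMod cs u hp_surj ((cs.reflJoin hp_surj hp_equiv hp_adjoin).opE t v) =
      quotByMk cs u p (e cs u t) * ofMod cs u hp_surj v := by
  suffices h : ofMod cs u hp_surj ∘ₗ (cs.reflJoin hp_surj hp_equiv hp_adjoin).opE t =
      LinearMap.mulLeft k (quotByMk cs u p (e cs u t)) ∘ₗ ofMod cs u hp_surj from
    LinearMap.congr_fun h v
  apply ReflJoin.ext_vec
  intro f w
  simp only [LinearMap.comp_apply, ReflJoin.opE_vec, ofMod_vec, LinearMap.mulLeft_apply]
  rw [← mul_assoc, e_mul_eElem]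

theorem ofMod_opL (i : B) (v : ReflJoin.Mod W F k) :
    ofMod cs u hp_surj ((cs.reflJoin hp_surj hp_equiv hp_adjoin).opL u i v) =
      quotByMk cs u p (g cs u i) * ofMod cs u hp_surj v := by
  suffices h : ofMod cs u hp_surj ∘ₗ (cs.reflJoin hp_surj hp_equiv hp_adjoin).opL u i =
      LinearMap.mulLeft k (quotByMk cs u p (g cs u i)) ∘ₗ ofMod cs u hp_surj from
    LinearMap.congr_fun h v
  apply ReflJoin.ext_vec
  intro f w
  simp only [LinearMap.comp_apply, ReflJoin.opL_vec, LinearMap.mulLeft_apply, map_add, ofMod_vec]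
  rw [← mul_assoc, g_mul_eElem cs u hp_surj hp_equiv, mul_assoc, ← map_mul]
  by_cases hD : cs.IsLeftDescent w i
  · have hw := g_mul_gElem cs u (cs.isLeftDescent_iff_not_isLeftDescent_mul.mp hD)
    rw [simple_mul_simple_cancel_left] at hw
    -- The factor `e_s` that the quadratic relation produces is absorbed into `e_{s • f}`; joining
    -- `s` to `s • f` or to `f` gives the same element.
    have hj : eElem cs u hp_surj ((cs.reflJoin hp_surj hp_equiv hp_adjoin).join
        (cs.reflSimple i) f) = eElem cs u hp_surj (cs.simple i • f) *
          quotByMk cs u p (e cs u (cs.reflSimple i)) := by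
      rw [← ReflJoin.join_simple_smul, ← e_mul_eElem]
      obtain ⟨J, hJ⟩ := exists_map_reflSpan_eq cs hp_surj (cs.simple i • f)
      rw [← hJ, eElem_map_reflSpan, ← map_mul, ← map_mul]
      congr 1
      exact Finset.noncommProd_commute _ _ _ _ fun t _ => e_commute cs u _ t
    -- At a descent `g_w = g_s g_{sw}`, so the quadratic relation applies to `g_s g_s`.
    have hg : g cs u i * gElem cs u w = gElem cs u (cs.simple i * w) +
        (u i - 1) • (e cs u (cs.reflSimple i) *
          (gElem cs u (cs.simple i * w) + gElem cs u w)) := by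
      nth_rw 1 [← hw]
      rw [← mul_assoc, g_mul_self, add_mul, one_mul, smul_mul_assoc, mul_assoc, add_mul, one_mul,
        hw]
    rw [if_pos hD, hg, map_smul, map_add, ofMod_vec, ofMod_vec, hj]
    simp only [map_add, map_smul, map_mul, mul_add, mul_smul_comm, mul_assoc, smul_add]
  · rw [if_neg hD, map_zero, add_zero, g_mul_gElem cs u hD]

theorem ofMod_rep (x : cs.ExtHecke u) (v : ReflJoin.Mod W F k) :
    ofMod cs u hp_surj ((cs.reflJoin hp_surj hp_equiv hp_adjoin).rep u hu x v) =
      quotByMk cs u p x * ofMod cs u hp_surj v := by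
  obtain ⟨x, rfl⟩ := RingQuot.mkAlgHom_surjective k (cs.ExtHeckeRel u) x
  induction x using FreeAlgebra.induction generalizing v with
  | grade0 r =>
    rw [AlgHom.commutes, AlgHom.commutes, AlgHom.commutes, Module.algebraMap_end_apply, map_smul,
      Algebra.smul_def]
  | grade1 a =>
    cases a with
    | g i =>
      change ofMod cs u hp_surj (ReflJoin.rep _ u hu (g cs u i) v) =
        quotByMk cs u p (g cs u i) * _
      rw [ReflJoin.rep_g, ofMod_opL]
    | e t =>
      change ofMod cs u hp_surj (ReflJoin.rep _ u hu (e cs u t) v) =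
        quotByMk cs u p (e cs u t) * _
      rw [ReflJoin.rep_e, ofMod_opE]
  | mul a b ha hb =>
    rw [map_mul, map_mul, map_mul, Module.End.mul_apply, ha, hb, mul_assoc]
  | add a b ha hb => rw [map_add, map_add, map_add, LinearMap.add_apply, map_add, ha, hb, add_mul]

open Classical in
theorem rep_eProd_vec (J L : Finset cs.Refl) (w : W) :
    (cs.reflJoin hp_surj hp_equiv hp_adjoin).rep u hu (eProd cs u J)
      (ReflJoin.vec k (p (cs.reflSpan L)) w) = ReflJoin.vec k (p (cs.reflSpan (J ∪ L))) w := by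
  induction J using Finset.induction_on with
  | empty => simp [eProd_empty]
  | insert t J _ ih =>
    rw [eProd_insert, map_mul, Module.End.mul_apply, ih, ReflJoin.rep_e, ReflJoin.opE_vec,
      reflJoin_join, adjoinRefl_reflSpan, Finset.insert_union]

/-- This lets the action pass to the quotient: `e_J` sends `p ⟨L⟩` to `p ⟨J ∪ L⟩`, which depends on
`J` only through `p ⟨J⟩`. -/
theorem rep_eProd_eq {J K : Finset cs.Refl} (h : p (cs.reflSpan J) = p (cs.reflSpan K)) :
    (cs.reflJoin hp_surj hp_equiv hp_adjoin).rep u hu (eProd cs u J) =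
      (cs.reflJoin hp_surj hp_equiv hp_adjoin).rep u hu (eProd cs u K) := by
  classical
  apply ReflJoin.ext_vec
  intro f w
  obtain ⟨L, rfl⟩ := exists_map_reflSpan_eq cs hp_surj f
  rw [rep_eProd_vec, rep_eProd_vec, cs.map_reflSpan_union_eq hp_equiv hp_adjoin h]

/-- The action of the quotient on the free module on `F × W`. -/
noncomputable def repQuot : QuotBy cs u p →ₐ[k] Module.End k (ReflJoin.Mod W F k) :=
  quotLift cs u ((cs.reflJoin hp_surj hp_equiv hp_adjoin).rep u hu)
    fun _ _ => rep_eProd_eq cs u hp_surj hp_equiv hp_adjoin hu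

/-- The linear map from the quotient to the free module on `F × W`, the action on the basis vector
of the trivial subgroup and `1`. -/
noncomputable def toMod : QuotBy cs u p →ₗ[k] ReflJoin.Mod W F k where
  toFun x := repQuot cs u hp_surj hp_equiv hp_adjoin hu x (ReflJoin.vec k (p (cs.reflSpan ∅)) 1)
  map_add' x y := by rw [map_add, LinearMap.add_apply]
  map_smul' c x := by rw [map_smul, LinearMap.smul_apply, RingHom.id_apply]

theorem toMod_quotByMk (x : cs.ExtHecke u) :
    toMod cs u hp_surj hp_equiv hp_adjoin hu (quotByMk cs u p x) =
      (cs.reflJoin hp_surj hp_equiv hp_adjoin).rep u hu x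
        (ReflJoin.vec k (p (cs.reflSpan ∅)) 1) := rfl

/-- The base vector is sent to `1`, so the intertwining property evaluated there returns `x`. -/
theorem ofMod_toMod (x : QuotBy cs u p) :
    ofMod cs u hp_surj (toMod cs u hp_surj hp_equiv hp_adjoin hu x) = x := by
  obtain ⟨x, rfl⟩ := RingCon.mkₐ_surjective (α := k) (idealOf cs u p).ringCon x
  change ofMod cs u hp_surj (toMod cs u hp_surj hp_equiv hp_adjoin hu (quotByMk cs u p x)) = _
  rw [toMod_quotByMk, ofMod_rep, ofMod_vec, eElem_map_reflSpan, eProd_empty, gElem_one, map_one,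
    mul_one, mul_one]

include hp_equiv in
theorem smul_map_reflSpan_empty (w : W) : w • p (cs.reflSpan ∅) = p (cs.reflSpan ∅) := by
  classical
  rw [← hp_equiv, smul_reflSpan, Finset.image_empty]

/-- Applied to the base vector, `g_w` changes only the second coordinate to `w`, because conjugation
fixes the trivial subgroup; then `e_J` turns the first into `p ⟨J⟩`. -/
theorem toMod_ofMod (v : ReflJoin.Mod W F k) :
    toMod cs u hp_surj hp_equiv hp_adjoin hu (ofMod cs u hp_surj v) = v := by
  classical
  suffices h : toMod cs u hp_surj hp_equiv hp_adjoin hu ∘ₗ ofMod cs u hp_surj = LinearMap.id from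
    LinearMap.congr_fun h v
  apply ReflJoin.ext_vec
  intro f w
  obtain ⟨J, rfl⟩ := exists_map_reflSpan_eq cs hp_surj f
  obtain ⟨ω, hω, rfl⟩ := cs.exists_isReduced w
  have hword : (cs.reflJoin hp_surj hp_equiv hp_adjoin).rep u hu (gWord cs u ω) =
      (cs.reflJoin hp_surj hp_equiv hp_adjoin).opWord u ω := by
    rw [gWord, map_list_prod, List.map_map, ReflJoin.opWord]
    congr 2
    funext i
    exact ReflJoin.rep_g _ u hu i
  rw [LinearMap.comp_apply, ofMod_vec, eElem_map_reflSpan, ← map_mul, toMod_quotByMk, map_mul,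
    Module.End.mul_apply, gElem_wordProd cs u hω, hword, ReflJoin.opWord_vec_one _ u hω,
    smul_map_reflSpan_empty cs hp_equiv, rep_eProd_vec, Finset.union_empty, LinearMap.id_apply]

/-- The basis `e_f g_w` of the quotient, indexed by `F × W`. -/
noncomputable def quotBasis : Module.Basis (F × W) k (QuotBy cs u p) :=
  Module.Basis.ofRepr
    { toMod cs u hp_surj hp_equiv hp_adjoin hu with
      invFun := ofMod cs u hp_surj
      left_inv := ofMod_toMod cs u hp_surj hp_equiv hp_adjoin hu
      right_inv := toMod_ofMod cs u hp_surj hp_equiv hp_adjoin hu }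

end ExtHecke

end CoxeterSystem

theorem mainTheorem7 {B W : Type*} [Group W] {M : CoxeterMatrix B} (cs : CoxeterSystem M W)
    {k : Type*} [CommRing k] (u : B → k)
    (hu : ∀ i j : B, IsConj (cs.simple i) (cs.simple j) → u i = u j)
    {F : Type*} [MulAction W F] (p : cs.FGReflSubgroup → F)
    (hp_surj : Function.Surjective p)
    (hp_equiv : ∀ (w : W) (H : cs.FGReflSubgroup), p (w • H) = w • p H)
    (hp_adjoin : ∀ H K : cs.FGReflSubgroup, p H = p K →
      ∀ i : B, p (cs.adjoinSimple H i) = p (cs.adjoinSimple K i)) :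
    Module.Free k (CoxeterSystem.ExtHecke.QuotBy cs u p) ∧
    (Finite W → Nonempty (Module.Basis (Fin (Nat.card W * Nat.card F)) k
      (CoxeterSystem.ExtHecke.QuotBy cs u p))) ∧
    ∃ f : CoxeterSystem.ExtHecke.QuotBy cs u p →ₐ[k] CoxeterSystem.IwahoriHecke M u,
      Function.Surjective f ∧
      f.comp (CoxeterSystem.ExtHecke.quotByMk cs u p) =
        CoxeterSystem.ExtHecke.toIwahoriHecke cs u := by
  open CoxeterSystem.ExtHecke in
  have b := quotBasis cs u hp_surj hp_equiv hp_adjoin hu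
  refine ⟨Module.Free.of_basis b, fun _ => ?_, ?_⟩
  · have : Finite cs.FGReflSubgroup := Subtype.finite
    have : Finite F := Finite.of_surjective p hp_surj
    refine ⟨b.reindex (Finite.equivFinOfCardEq ?_)⟩
    rw [Nat.card_prod, mul_comm]
  · have h (J K : Finset cs.Refl) (_ : p (cs.reflSpan J) = p (cs.reflSpan K)) :
        toIwahoriHecke cs u (eProd cs u J) = toIwahoriHecke cs u (eProd cs u K) := by
      rw [toIwahoriHecke_eProd, toIwahoriHecke_eProd]
    refine ⟨quotLift cs u (toIwahoriHecke cs u) h, fun y => ?_,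
      AlgHom.ext fun x => quotLift_quotByMk cs u _ h x⟩
    obtain ⟨x, rfl⟩ := toIwahoriHecke_surjective cs u y
    exact ⟨quotByMk cs u p x, quotLift_quotByMk cs u _ h x⟩
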